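/- Consider smooth vector fields on $\mathbb R^2$. For a nonnegative integer $k$, $f\in C^\infty(\mathbb R^2,\mathbb R^2)$ and a positive continuous function $r$ on $\mathbb R^2$ put $$\mathcal V(k,f,r)=\Big\{g\in C^\infty(\mathbb R^2,\mathbb R^2)\ :\ \big\|\tfrac{\partial^{|I|}(f-g)}{\partial x^I}(x)\big\|<r(x)\ \ \forall x\in\mathbb R^2,\ |I|\le k\Big\};$$ these sets form a base of the Whitney topology. Let $\mathrm{GAS}(\mathbb R^2)$ be the set of smooth vector fields which vanish and are globally asymptotically stable at the origin, with the induced topology; $\mathrm{GAS}(\mathbb R^2)\times\mathrm{GAS}(\mathbb R^2)$ has the product topology. For a pair $(X,Y)$ in it let $Q(p)=\det(X(p),Y(p))$ and $\mathcal Z=Q^{-1}(0)$. A component of $\mathcal Z$ is a connected component of $\mathcal Z\setminus\{0\}$; it is inverse if $X$ and $Y$ have opposite directions at its points. A point $p\in\mathcal Z\setminus\{0\}$ is a tangency point if $X(p)$ is tangent to $\mathcal Z$ at $p$. Consider the conditions - (G1) if $p\ne0$ and $Q(p)=0$, then $\nabla Q(p)\neq0$; - (G2) the Hessian matrix of $Q$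 at the origin is non-degenerate; - (G3) if $p\neq0$, $Q(p)=0$ and $\nabla Q(p)\perp X(p)$, then the second derivative of $Q$ along $X$ at $p$, i.e. $X(XQ)(p)$ where $Xh=\nabla h\cdot X$, is different from zero. **Theorem.** Let $(X,Y)\in \mathrm{GAS}(\mathbb R^2)\times\mathrm{GAS}(\mathbb R^2)$ satisfy (G1) and (G2). Each of the following conditions, if it holds for $(X,Y)$, holds for all the pairs in some neighborhood of $(X,Y)$ in $\mathrm{GAS}(\mathbb R^2)\times\mathrm{GAS}(\mathbb R^2)$: 1. $\mathcal Z=\{0\}$; 2. (G1) and (G2) hold, the origin is isolated in $\mathcal Z$, and there is no tangency point in $\mathcal Z\setminus\{0\}$; 3. $\mathcal Z$ is compact; 4. $\mathcal Z$ is compact, the eigenvalues of $A=DX(0)$ and $B=DY(0)$ have strictly negative real part, and the linearized switched system $\dot q=uAq+(1-u)Bq$, with $u:[0,\infty)\to[0,1]$ an arbitrary measurable function, is globally asymptotically stable at the origin uniformly with respect to $u$ (uniformly stable, and such that for all $\delta_1,\delta_2>0$ there is a $T>0$ for which every trajectory issued from the ball $B_{\delta_2}$ is in $B_{\delta_1}$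 at time $T$); 5. $\mathcal Z$ has an inverse component; 6. (G1) and (G3) hold and $\mathcal Z$ has an unbounded inverse component; here it is assumed in addition that, as a further generic condition, either $DX(0)$ and $DY(0)$ have no common real eigenvector, or (G3) holds at all the pairs of some neighborhood of $(X,Y)$. (These are the hypotheses of stability criteria: 1 and 2 for global uniform asymptotic stability of the switched system $\dot q=uX(q)+(1-u)Y(q)$, $u\in[0,1]$; 3 for its boundedness; 4 for global uniform stability; 5 for the failure of global attractivity; 6 for unboundedness.) -/

import Mathlib

open Set Filter Topology MeasureTheory
open scoped ContDiff

noncomputable section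

namespace PlanarSwitched

/-- The Euclidean plane. -/
abbrev Plane := EuclideanSpace ℝ (Fin 2)

/-! ### Switched systems and stability -/

/-- Measurable switching functions with values in `U`. -/
def IsSwitching (U : Set ℝ) (u : ℝ → ℝ) : Prop :=
  Measurable u ∧ ∀ t, u t ∈ U

/-- `γ` is, on `[0, T]`, the (Carathéodory) solution of `q' = f (u t) q` starting at `p`. -/
def IsTrajectory (f : ℝ → Plane → Plane) (u : ℝ → ℝ) (p : Plane) (T : ℝ) (γ : ℝ → Plane) : Prop :=
  ContinuousOn γ (Icc 0 T) ∧
    IntervalIntegrable (fun s => f (u s) (γ s)) volume 0 T ∧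
    ∀ t ∈ Icc 0 T, γ t = p + ∫ s in (0 : ℝ)..t, f (u s) (γ s)

/-- The set of points accessible from `p`. -/
def accessibleSet (f : ℝ → Plane → Plane) (U : Set ℝ) (p : Plane) : Set Plane :=
  {q | ∃ u γ T, IsSwitching U u ∧ 0 ≤ T ∧ IsTrajectory f u p T γ ∧ γ T = q}

/-- Uniform stability at the origin. -/
def UniformlyStable (f : ℝ → Plane → Plane) (U : Set ℝ) : Prop :=
  ∀ δ > 0, ∃ ε > 0, ∀ p ∈ Metric.ball (0 : Plane) ε, accessibleSet f U p ⊆ Metric.ball 0 δ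

/-- Global attractivity: every solution is defined for all times and converges to the origin. -/
def GloballyAttractive (f : ℝ → Plane → Plane) (U : Set ℝ) : Prop :=
  ∀ u, IsSwitching U u → ∀ p : Plane,
    ∃ γ : ℝ → Plane, (∀ T ≥ 0, IsTrajectory f u p T γ) ∧ Tendsto γ atTop (𝓝 0)

/-- Global uniform attractivity: a common time `T` brings one ball into the other. -/
def GloballyUniformlyAttractive (f : ℝ → Plane → Plane) (U : Set ℝ) : Prop :=
  ∀ δ₁ > 0, ∀ δ₂ > 0, ∃ T > 0, ∀ u, IsSwitching U u → ∀ p ∈ Metric.ball (0 : Plane) δ₂,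
    ∃ γ : ℝ → Plane, IsTrajectory f u p T γ ∧ γ T ∈ Metric.ball 0 δ₁

/-- Global asymptotic stability. -/
def IsGAS (f : ℝ → Plane → Plane) (U : Set ℝ) : Prop :=
  UniformlyStable f U ∧ GloballyAttractive f U

/-- Global uniform asymptotic stability. -/
def IsGUAS (f : ℝ → Plane → Plane) (U : Set ℝ) : Prop :=
  UniformlyStable f U ∧ GloballyUniformlyAttractive f U

/-- The family `u X + (1 - u) Y`. -/
def switchedFamily (X Y : Plane → Plane) (u : ℝ) (q : Plane) : Plane :=
  u • X q + (1 - u) • Y q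

/-! ### Smooth vector fields and the Whitney topology -/

/-- The partial derivative in the `i`-th coordinate. -/
def pderiv {F : Type*} [NormedAddCommGroup F] [NormedSpace ℝ F] (i : Fin 2)
    (g : Plane → F) : Plane → F :=
  fun x => fderiv ℝ g x (EuclideanSpace.single i 1)

/-- The partial derivative with multi-index `I`. -/
def multiDeriv (I : Fin 2 → ℕ) (g : Plane → Plane) : Plane → Plane :=
  (pderiv 0)^[I 0] ((pderiv 1)^[I 1] g)

/-- Smooth vector fields on the plane. -/
structure SmoothField where
  toFun : Plane → Plane
  smooth : ContDiff ℝ ∞ toFun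

/-- The basic Whitney neighbourhoods. -/
def whitneyBall (k : ℕ) (f : SmoothField) (r : Plane → ℝ) : Set SmoothField :=
  {g | ∀ x, ∀ I : Fin 2 → ℕ, I 0 + I 1 ≤ k →
    ‖multiDeriv I (fun y => f.toFun y - g.toFun y) x‖ < r x}

/-- The Whitney topology. -/
instance : TopologicalSpace SmoothField :=
  TopologicalSpace.generateFrom
    {V | ∃ k f r, Continuous r ∧ (∀ x, 0 < r x) ∧ V = whitneyBall k f r}

/-- The smooth vector fields vanishing and globally asymptotically stable at the origin
(a single vector field is a switched system with one admissible velocity). -/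
def GASField : Type :=
  {X : SmoothField // X.toFun 0 = 0 ∧ IsGAS (fun _ => X.toFun) {0}}

instance : CoeFun GASField (fun _ => Plane → Plane) := ⟨fun X => X.1.toFun⟩

/-- The topology induced by the Whitney topology. -/
instance : TopologicalSpace GASField :=
  TopologicalSpace.induced (fun X : GASField => X.1) inferInstance

/-! ### The collinearity set -/

/-- `Q(p) = det (X(p), Y(p))`. -/
def Q (X Y : Plane → Plane) (p : Plane) : ℝ :=
  Matrix.det !![X p 0, Y p 0; X p 1, Y p 1]

/-- The set `Z` on which `X` and `Y` are parallel. -/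
def Z (X Y : Plane → Plane) : Set Plane := {p | Q X Y p = 0}

/-- `Γ` is a connected component of `Z \ {0}`. -/
def IsComponent (X Y : Plane → Plane) (Γ : Set Plane) : Prop :=
  ∃ p ∈ Z X Y \ {0}, Γ = connectedComponentIn (Z X Y \ {0}) p

/-- `Γ` is a component on which `X` and `Y` have opposite directions. -/
def IsInverseComponent (X Y : Plane → Plane) (Γ : Set Plane) : Prop :=
  IsComponent X Y Γ ∧ ∀ p ∈ Γ, X p ≠ 0 ∧ ∃ c < (0 : ℝ), Y p = c • X p

/-- `p ∈ Z \ {0}` is a tangency point if `X p` is tangent to `Z` at `p`,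
i.e. it is the velocity at `p` of a curve in `Z \ {0}`. -/
def IsTangencyPoint (X Y : Plane → Plane) (p : Plane) : Prop :=
  p ∈ Z X Y \ {0} ∧
    ∃ c : ℝ → Plane, c 0 = p ∧ HasDerivAt c (X p) 0 ∧ ∀ᶠ t in 𝓝 (0 : ℝ), c t ∈ Z X Y \ {0}

/-- Derivative of the function `h` along the vector field `X`. -/
def lieDeriv (X : Plane → Plane) (h : Plane → ℝ) : Plane → ℝ :=
  fun p => fderiv ℝ h p (X p)

/-! ### Generic conditions -/

/-- `∇Q ≠ 0` on `Z \ {0}`. -/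
def G1 (X Y : Plane → Plane) : Prop :=
  ∀ p, p ≠ 0 → Q X Y p = 0 → gradient (Q X Y) p ≠ 0

/-- The Hessian matrix of `Q` at the origin is non-degenerate. -/
def G2 (X Y : Plane → Plane) : Prop :=
  (Matrix.of fun i j : Fin 2 => pderiv i (pderiv j (Q X Y)) 0).det ≠ 0

/-- At the points of `Z \ {0}` where `∇Q` is orthogonal to `X`, the second derivative of `Q`
along `X` does not vanish. -/
def G3 (X Y : Plane → Plane) : Prop :=
  ∀ p, p ≠ 0 → Q X Y p = 0 → inner ℝ (gradient (Q X Y) p) (X p) = 0 →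
    lieDeriv X (lieDeriv X (Q X Y)) p ≠ 0

/-- The linearizations of `X` and `Y` at the origin have no common real eigenvector. -/
def NoCommonEigenvector (X Y : Plane → Plane) : Prop :=
  ¬ ∃ v : Plane, v ≠ 0 ∧ ∃ a b : ℝ, fderiv ℝ X 0 v = a • v ∧ fderiv ℝ Y 0 v = b • v

/-! ### The linearized system -/

/-- The Jacobian matrix at the origin. -/
def jacobian (X : Plane → Plane) : Matrix (Fin 2) (Fin 2) ℝ :=
  Matrix.of fun i j => pderiv j X 0 i

/-- All (complex) eigenvalues have strictly negative real part. -/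
def IsHurwitz (A : Matrix (Fin 2) (Fin 2) ℝ) : Prop :=
  ∀ μ ∈ spectrum ℂ (A.map (fun x : ℝ => (x : ℂ))), μ.re < 0

/-! ### The hypotheses of the stability criteria -/

/-- `Z = {0}` (criterion for GUAS). -/
def CritOriginOnly (X Y : Plane → Plane) : Prop := Z X Y = {0}

/-- Generic criterion for GUAS without tangency points. -/
def CritNoTangency (X Y : Plane → Plane) : Prop :=
  G1 X Y ∧ G2 X Y ∧ (∀ᶠ p in 𝓝[≠] (0 : Plane), p ∉ Z X Y) ∧ ∀ p, ¬ IsTangencyPoint X Y p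

/-- `Z` compact (criterion for boundedness). -/
def CritCompact (X Y : Plane → Plane) : Prop := IsCompact (Z X Y)

/-- Criterion for GUS: `Z` is compact and the linearized switched system is non-degenerate
and GUAS. -/
def CritLinearized (X Y : Plane → Plane) : Prop :=
  IsCompact (Z X Y) ∧ (IsHurwitz (jacobian X) ∧ IsHurwitz (jacobian Y)) ∧
    IsGUAS (switchedFamily (fderiv ℝ X 0) (fderiv ℝ Y 0)) (Icc 0 1)

/-- Existence of an inverse component (obstruction to global attractivity). -/
def CritInverse (X Y : Plane → Plane) : Prop := ∃ Γ, IsInverseComponent X Y Γ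

/-- Generic criterion for unboundedness. -/
def CritUnboundedInverse (X Y : Plane → Plane) : Prop :=
  G1 X Y ∧ G3 X Y ∧ ∃ Γ, IsInverseComponent X Y Γ ∧ ¬ Bornology.IsBounded Γ

/-- The property `P` holds for all pairs in a neighbourhood of `(X, Y)` in `GAS × GAS`. -/
def HoldsNear (P : (Plane → Plane) → (Plane → Plane) → Prop) (X Y : GASField) : Prop :=
  ∀ᶠ W in 𝓝 (X, Y), P W.1 W.2

end PlanarSwitched

end

/-!
# Robustness of the stability criteria for planar switched systems

Everything is derived from closeness of 2-jets. The filter `jetFilter X Y c` consists of the pairs of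
fields that are `C²`-close to `(X, Y)` on the unit ball around `c`; the values, the first and the
second derivatives of the fields, hence `Q`, `∇Q` and `X(XQ)`, converge along it. A property of a
point and a pair that holds, for each `c`, eventually along `jetFilter X Y c ×ˢ 𝓝 c`, holds at all
points for all pairs in a Whitney neighbourhood (`globalize`, `globalize_param`): finitely many local
neighbourhoods suffice on each ball, and a continuous positive minorant of the resulting radii is the
gauge `r` of the Whitney neighbourhood.

Open conditions at a point `c ≠ 0` are local in this sense for free. At the origin all fields vanish,
and one rescales: `t⁻¹ W(t w)` converges to the linearization, so `t⁻² Q(t w)` and `t⁻¹ ∇Q(t w)`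
converge to the quadratic form `quadQ` and to the Hessian `hessQ`, non-degenerate by `(G2)`. This
gives `(G1)` and `(G2)` for nearby pairs. If the origin is isolated in `Z`, the Hessian is definite
(`quadQ_ne_zero`), hence the origin is uniformly isolated. For `(G3)`, a tangency close to the origin
would be a tangency of both fields, which are parallel and non-zero on `Z \ {0}` by global asymptotic
stability; in the limit this produces a common eigenvector of the linearizations (`eventually_G3`).
Since neither field vanishes off the origin, a component of `Z` is inverse as soon as the fields have
opposite directions at one of its points, so an inverse component persists by the intermediate value
theorem on a segment transverse to `Z`.

For an unbounded inverse component `Γ`, each `p ∈ Γ` is moved to the unique zero of the perturbed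
determinant on the segment `p + s ∇Q(p)`, `|s| ≤ τ(p)`, where `τ` is a suitable continuous positive
function (`exists_param_dQ_gradQ`, `eventually_abs_Q_lt`). This map is continuous and moves `p` by
less than `‖p‖ / 2`, so the image of `Γ` is a connected unbounded subset of the perturbed set without
the origin (`eventually_unbounded_inverseComponent`).

For the linearized system, uniform attractivity is contraction by `1 / 2` in some fixed time, which by
Grönwall's inequality survives small perturbations of the two matrices (`exists_contraction_time`);
iterating the contraction gives back global uniform asymptotic stability (`isGUAS_of_contraction`),
the solutions for measurable switching functions being provided by the Picard series.
-/

noncomputable section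

namespace PlanarSwitched

/-! ### From the Whitney topology to local closeness of 2-jets -/

lemma SmoothField.contDiff (X : SmoothField) : ContDiff ℝ ∞ X.toFun := X.smooth

/-- The 2-jets of `f` and `g` at `x` are within `e` of each other. -/
def C2Near (f g : Plane → Plane) (e : ℝ) (x : Plane) : Prop :=
  ‖g x - f x‖ < e ∧ ‖fderiv ℝ g x - fderiv ℝ f x‖ < e ∧
    ‖fderiv ℝ (fderiv ℝ g) x - fderiv ℝ (fderiv ℝ f) x‖ < e

lemma C2Near.mono {f g : Plane → Plane} {e e' : ℝ} {x : Plane} (h : C2Near f g e x)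
    (hee : e ≤ e') : C2Near f g e' x :=
  ⟨h.1.trans_le hee, h.2.1.trans_le hee, h.2.2.trans_le hee⟩

lemma plane_eq_sum (v : Plane) :
    v = v 0 • EuclideanSpace.single 0 (1 : ℝ) + v 1 • EuclideanSpace.single 1 (1 : ℝ) := by
  ext i
  fin_cases i <;> simp

lemma clm_norm_le_sum {F : Type*} [NormedAddCommGroup F] [NormedSpace ℝ F] (L : Plane →L[ℝ] F) :
    ‖L‖ ≤ ‖L (EuclideanSpace.single 0 1)‖ + ‖L (EuclideanSpace.single 1 1)‖ := by
  refine L.opNorm_le_bound (by positivity) fun v => ?_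
  have hc : ∀ i, ‖v i‖ ≤ ‖v‖ := fun i => PiLp.norm_apply_le v i
  calc ‖L v‖ = ‖v 0 • L (EuclideanSpace.single 0 1) + v 1 • L (EuclideanSpace.single 1 1)‖ := by
        conv_lhs => rw [plane_eq_sum v]
        simp
    _ ≤ ‖v 0‖ * ‖L (EuclideanSpace.single 0 1)‖ + ‖v 1‖ * ‖L (EuclideanSpace.single 1 1)‖ := by
        refine (norm_add_le _ _).trans ?_
        rw [norm_smul, norm_smul]
    _ ≤ ‖v‖ * ‖L (EuclideanSpace.single 0 1)‖ + ‖v‖ * ‖L (EuclideanSpace.single 1 1)‖ := by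
        gcongr <;> exact hc _
    _ = _ := by ring

lemma pderiv_pderiv_eq {F : Type*} [NormedAddCommGroup F] [NormedSpace ℝ F] {g : Plane → F}
    (hg : ContDiff ℝ 2 g) (i j : Fin 2) (x : Plane) :
    pderiv i (pderiv j g) x =
      fderiv ℝ (fderiv ℝ g) x (EuclideanSpace.single i 1) (EuclideanSpace.single j 1) := by
  have hd : DifferentiableAt ℝ (fderiv ℝ g) x :=
    ((hg.fderiv_right (m := 1) (by norm_num)).differentiable one_ne_zero) x
  unfold pderiv
  rw [fderiv_clm_apply hd (differentiableAt_const _)]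
  simp

lemma c2Near_of_mem_whitneyBall {X W : SmoothField} {r : Plane → ℝ} (h : W ∈ whitneyBall 2 X r)
    (x : Plane) {e : ℝ} (he : 4 * r x ≤ e) : C2Near X.toFun W.toFun e x := by
  set g : Plane → Plane := fun y => X.toFun y - W.toFun y with hg
  have hX := X.contDiff.of_le (m := 2) (by norm_cast)
  have hW := W.contDiff.of_le (m := 2) (by norm_cast)
  have hgs : ContDiff ℝ 2 g := hX.sub hW
  have key : ∀ i j : ℕ, i + j ≤ 2 → ‖(pderiv 0)^[i] ((pderiv 1)^[j] g) x‖ < r x := by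
    intro i j hij
    have := h x ![i, j] (by simpa using hij)
    simpa [multiDeriv] using this
  have h00 : ‖g x‖ < r x := key 0 0 (by norm_num)
  have h10 : ‖fderiv ℝ g x (EuclideanSpace.single 0 1)‖ < r x := key 1 0 (by norm_num)
  have h01 : ‖fderiv ℝ g x (EuclideanSpace.single 1 1)‖ < r x := key 0 1 (by norm_num)
  have h20 : ‖pderiv 0 (pderiv 0 g) x‖ < r x := key 2 0 (by norm_num)
  have h11 : ‖pderiv 0 (pderiv 1 g) x‖ < r x := key 1 1 (by norm_num)
  have h02 : ‖pderiv 1 (pderiv 1 g) x‖ < r x := key 0 2 (by norm_num)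
  have h11' : ‖pderiv 1 (pderiv 0 g) x‖ < r x := by
    rw [pderiv_pderiv_eq hgs] at h11 ⊢
    rwa [(hgs.contDiffAt.isSymmSndFDerivAt (by simp)) _ _]
  rw [pderiv_pderiv_eq hgs] at h20 h11 h02 h11'
  have hr : 0 < r x := (norm_nonneg _).trans_lt h00
  have hdX := hX.differentiable two_ne_zero
  have hdW := hW.differentiable two_ne_zero
  have e1 : ∀ y, fderiv ℝ g y = fderiv ℝ X.toFun y - fderiv ℝ W.toFun y := fun y =>
    fderiv_fun_sub (hdX y) (hdW y)
  have e2 : fderiv ℝ (fderiv ℝ g) x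
      = fderiv ℝ (fderiv ℝ X.toFun) x - fderiv ℝ (fderiv ℝ W.toFun) x := by
    rw [funext e1]
    exact fderiv_fun_sub
      (((hX.fderiv_right (m := 1) (by norm_num)).differentiable one_ne_zero) x)
      (((hW.fderiv_right (m := 1) (by norm_num)).differentiable one_ne_zero) x)
  refine ⟨?_, ?_, ?_⟩
  · rw [norm_sub_rev]
    exact h00.trans_le (by linarith)
  · rw [norm_sub_rev, ← e1]
    exact (clm_norm_le_sum _).trans_lt (by linarith)
  · rw [norm_sub_rev (E := Plane →L[ℝ] Plane →L[ℝ] Plane), ← e2]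
    refine (clm_norm_le_sum _).trans_lt ?_
    have a := clm_norm_le_sum (fderiv ℝ (fderiv ℝ g) x (EuclideanSpace.single 0 1))
    have b := clm_norm_le_sum (fderiv ℝ (fderiv ℝ g) x (EuclideanSpace.single 1 1))
    linarith

lemma self_mem_whitneyBall (k : ℕ) (X : SmoothField) {r : Plane → ℝ} (hr : ∀ x, 0 < r x) :
    X ∈ whitneyBall k X r := by
  intro x I _
  have h0 : ∀ i, pderiv i (fun _ : Plane => (0 : Plane)) = fun _ => 0 := by
    intro i
    funext x
    simp [pderiv]
  have : multiDeriv I (fun y => X.toFun y - X.toFun y) = fun _ => 0 := by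
    simp only [sub_self, multiDeriv]
    rw [Function.iterate_fixed (h0 1), Function.iterate_fixed (h0 0)]
  rw [this]
  simpa using hr x

lemma whitneyBall_mem_nhds (X : GASField) {r : Plane → ℝ} (hc : Continuous r) (hr : ∀ x, 0 < r x) :
    {W : GASField | W.1 ∈ whitneyBall 2 X.1 r} ∈ 𝓝 X := by
  have ho : IsOpen (whitneyBall 2 X.1 r) :=
    TopologicalSpace.isOpen_generateFrom_of_mem ⟨2, X.1, r, hc, hr, rfl⟩
  exact IsOpen.mem_nhds (isOpen_induced ho) (self_mem_whitneyBall 2 X.1 hr)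

/-- A function that is locally bounded below by positive constants has a continuous positive
minorant. -/
lemma exists_continuous_pos_le (g : Plane → ℝ) (hg : ∀ x, ∃ c > 0, ∀ᶠ y in 𝓝 x, c ≤ g y) :
    ∃ r : Plane → ℝ, Continuous r ∧ ∀ x, 0 < r x ∧ r x ≤ g x := by
  obtain ⟨r, hr⟩ := exists_continuous_forall_mem_convex_of_local_const
    (t := fun x => Ioc 0 (g x)) (fun x => convex_Ioc 0 (g x)) (fun x => by
      obtain ⟨c, hc, h⟩ := hg x
      exact ⟨c, h.mono fun y hy => ⟨hc, hy⟩⟩)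
  exact ⟨r, r.continuous, fun x => hr x⟩

/-- The pairs of fields whose 2-jets are within `e` of those of `(X, Y)` at `x`. -/
def PairNear (X Y : GASField) (e : ℝ) (x : Plane) (W : GASField × GASField) : Prop :=
  C2Near X.1.toFun W.1.1.toFun e x ∧ C2Near Y.1.toFun W.2.1.toFun e x

lemma PairNear.mono {X Y : GASField} {e e' : ℝ} {x : Plane} {W : GASField × GASField}
    (h : PairNear X Y e x W) (hee : e ≤ e') : PairNear X Y e' x W :=
  ⟨h.1.mono hee, h.2.mono hee⟩

lemma eventually_pairNear (X Y : GASField) {r : Plane → ℝ} (hc : Continuous r)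
    (hr : ∀ x, 0 < r x) : ∀ᶠ W in 𝓝 (X, Y), ∀ x, PairNear X Y (r x) x W := by
  have hc' : Continuous fun x => r x / 4 := hc.div_const 4
  have hr' : ∀ x, 0 < r x / 4 := fun x => by have := hr x; positivity
  have h1 := whitneyBall_mem_nhds X hc' hr'
  have h2 := whitneyBall_mem_nhds Y hc' hr'
  rw [nhds_prod_eq]
  filter_upwards [prod_mem_prod h1 h2] with W hW x
  exact ⟨c2Near_of_mem_whitneyBall hW.1 x (by linarith),
    c2Near_of_mem_whitneyBall hW.2 x (by linarith)⟩

/-- The filter of pairs of fields that are `C²`-close to `(X, Y)` on the unit ball around `c`. -/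
def jetFilter (X Y : GASField) (c : Plane) : Filter (GASField × GASField) :=
  ⨅ (e : ℝ) (_ : 0 < e), 𝓟 {W | ∀ x ∈ Metric.ball c 1, PairNear X Y e x W}

lemma jetFilter_hasBasis (X Y : GASField) (c : Plane) :
    (jetFilter X Y c).HasBasis (fun e : ℝ => 0 < e)
      (fun e => {W | ∀ x ∈ Metric.ball c 1, PairNear X Y e x W}) := by
  refine hasBasis_biInf_principal' (fun i hi j hj => ⟨min i j, lt_min hi hj, ?_, ?_⟩) ⟨1, one_pos⟩
  · exact fun W hW x hx => (hW x hx).mono (min_le_left _ _)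
  · exact fun W hW x hx => (hW x hx).mono (min_le_right _ _)

lemma nhds_le_jetFilter (X Y : GASField) (c : Plane) : 𝓝 (X, Y) ≤ jetFilter X Y c := by
  rw [(jetFilter_hasBasis X Y c).ge_iff]
  intro e he
  filter_upwards [eventually_pairNear X Y continuous_const fun _ => he] with W hW x _
  exact hW x

/-- A property of a point, a pair of fields and a small parameter that holds locally, for pairs
close to `(X, Y)` in the `C²` sense near each point, holds at all points for all pairs in a Whitney
neighbourhood, with parameters bounded by a positive continuous function. -/
lemma globalize_param {X Y : GASField} {P : GASField × GASField → ℝ → Plane → Prop}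
    (h : ∀ c, ∀ᶠ z in (jetFilter X Y c ×ˢ 𝓝 (0 : ℝ)) ×ˢ 𝓝 c, P z.1.1 z.1.2 z.2) :
    ∃ τ : Plane → ℝ, Continuous τ ∧ (∀ x, 0 < τ x) ∧
      ∀ᶠ W in 𝓝 (X, Y), ∀ p s, |s| ≤ τ p → P W s p := by
  -- Closeness is required only near the point `p` itself, so that the radius may shrink at infinity.
  have hK : ∀ K : Set Plane, IsCompact K → ∃ e > 0, ∀ W, ∀ p ∈ K,
      (∀ x ∈ Metric.ball p 2, PairNear X Y e x W) → ∀ s, |s| ≤ e → P W s p := by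
    intro K hK
    refine hK.induction_on ⟨1, one_pos, fun W p hp => hp.elim⟩ ?_ ?_ ?_
    · intro K K' hKK ih
      obtain ⟨e, he, h⟩ := ih
      exact ⟨e, he, fun W p hp => h W p (hKK hp)⟩
    · intro K K' ih ih'
      obtain ⟨e, he, h⟩ := ih
      obtain ⟨e', he', h'⟩ := ih'
      refine ⟨min e e', lt_min he he', fun W p hp hW s hs => ?_⟩
      rcases hp with hp | hp
      · exact h W p hp (fun x hx => (hW x hx).mono (min_le_left _ _)) s
          (hs.trans (min_le_left _ _))
      · exact h' W p hp (fun x hx => (hW x hx).mono (min_le_right _ _)) s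
          (hs.trans (min_le_right _ _))
    · intro c _
      obtain ⟨S, hS, U, hU, hSU⟩ := mem_prod_iff.1 (h c)
      obtain ⟨S1, hS1, S2, hS2, hS12⟩ := mem_prod_iff.1 hS
      obtain ⟨e, he, heS⟩ := (jetFilter_hasBasis X Y c).mem_iff.1 hS1
      obtain ⟨d, hd, hdS⟩ := Metric.mem_nhds_iff.1 hS2
      refine ⟨U ∩ Metric.ball c 1, mem_nhdsWithin_of_mem_nhds
        (inter_mem hU (Metric.ball_mem_nhds c one_pos)), min e (d / 2), by positivity,
        fun W p hp hW s hs => ?_⟩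
      refine @hSU ((W, s), p) ⟨@hS12 (W, s) ⟨heS fun x hx => ?_, hdS ?_⟩, hp.1⟩
      · refine (hW x ?_).mono (min_le_left _ _)
        have h1 := Metric.mem_ball.1 hx
        have h2 := Metric.mem_ball'.1 hp.2
        have h3 := dist_triangle x c p
        exact Metric.mem_ball.2 (by linarith)
      · rw [mem_ball_zero_iff, Real.norm_eq_abs]
        have := hs.trans (min_le_right _ _)
        linarith
  choose e he hP using fun n : ℕ => hK (Metric.closedBall 0 n) (isCompact_closedBall 0 (n : ℝ))
  -- The running minimum of `e` makes the radii decrease with the distance to the origin.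
  set d : ℕ → ℝ := fun N => (Finset.range (N + 1)).inf' Finset.nonempty_range_add_one e with hd
  have hdpos : ∀ N, 0 < d N := fun N =>
    (Finset.lt_inf'_iff _).2 fun i _ => he i
  have hde : ∀ n N, n ≤ N → d N ≤ e n := fun n N hnN =>
    Finset.inf'_le _ (by simpa using Nat.lt_succ_of_le hnN)
  have hanti : ∀ n N, n ≤ N → d N ≤ d n := fun n N hnN =>
    Finset.inf'_mono _ (by
      intro i hi
      simp only [Finset.mem_range] at hi ⊢
      omega) _
  obtain ⟨r, hrc, hr⟩ := exists_continuous_pos_le (fun x => d (⌈‖x‖⌉₊ + 3)) (fun x => by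
    refine ⟨d (⌈‖x‖⌉₊ + 4), hdpos _, ?_⟩
    filter_upwards [Metric.ball_mem_nhds x one_pos] with y hy
    refine hanti _ _ ?_
    have h1 : ‖y‖ ≤ ‖x‖ + 1 := by
      have := norm_le_norm_add_norm_sub' y x
      have h2 := mem_ball_iff_norm.1 hy
      linarith
    have h2 : ⌈‖y‖⌉₊ ≤ ⌈‖x‖⌉₊ + 1 := by
      rw [Nat.ceil_le]
      push_cast
      linarith [Nat.le_ceil ‖x‖]
    omega)
  refine ⟨r, hrc, fun x => (hr x).1, ?_⟩
  filter_upwards [eventually_pairNear X Y hrc fun x => (hr x).1] with W hW p s hs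
  refine hP ⌈‖p‖⌉₊ W p ?_ (fun x hx => (hW x).mono ?_) s ?_
  · rw [mem_closedBall_zero_iff]
    exact Nat.le_ceil _
  · refine (hr x).2.trans (hde _ _ ?_)
    have h1 : ‖p‖ ≤ ‖x‖ + 2 := by
      have := norm_le_norm_add_norm_sub' p x
      have h2 := mem_ball_iff_norm'.1 hx
      linarith
    have h2 : ⌈‖p‖⌉₊ ≤ ⌈‖x‖⌉₊ + 2 := by
      rw [Nat.ceil_le]
      push_cast
      linarith [Nat.le_ceil ‖x‖]
    omega
  · exact hs.trans ((hr p).2.trans (hde _ _ (by omega)))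

lemma globalize {X Y : GASField} {P : GASField × GASField → Plane → Prop}
    (h : ∀ c, ∀ᶠ z in jetFilter X Y c ×ˢ 𝓝 c, P z.1 z.2) :
    ∀ᶠ W in 𝓝 (X, Y), ∀ p, P W p := by
  obtain ⟨τ, -, hτ, H⟩ := globalize_param (P := fun W _ p => P W p) (X := X) (Y := Y) fun c => by
    have : Tendsto (fun z : ((GASField × GASField) × ℝ) × Plane => (z.1.1, z.2))
        ((jetFilter X Y c ×ˢ 𝓝 (0 : ℝ)) ×ˢ 𝓝 c) (jetFilter X Y c ×ˢ 𝓝 c) :=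
      (tendsto_fst.comp tendsto_fst).prodMk tendsto_snd
    exact this.eventually (h c)
  filter_upwards [H] with W hW p
  exact hW p 0 (by simpa using (hτ p).le)

/-! ### The determinant as a bilinear map and the derivatives of `Q` -/

/-- The determinant of two plane vectors, as a continuous bilinear map. -/
def cross : Plane →L[ℝ] Plane →L[ℝ] ℝ :=
  (EuclideanSpace.proj 0 : Plane →L[ℝ] ℝ).smulRight (EuclideanSpace.proj 1 : Plane →L[ℝ] ℝ) -
    (EuclideanSpace.proj 1 : Plane →L[ℝ] ℝ).smulRight (EuclideanSpace.proj 0 : Plane →L[ℝ] ℝ)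

lemma cross_apply (a b : Plane) : cross a b = a 0 * b 1 - a 1 * b 0 := by
  simp [cross]

lemma Q_eq (f g : Plane → Plane) (p : Plane) : Q f g p = cross (f p) (g p) := by
  rw [Q, Matrix.det_fin_two_of, cross_apply]; ring

lemma exists_smul_of_cross_eq_zero {a b : Plane} (ha : a ≠ 0) (h : cross a b = 0) :
    ∃ c : ℝ, b = c • a := by
  rw [cross_apply] at h
  by_cases h0 : a 0 = 0
  · have h1 : a 1 ≠ 0 := by
      intro h1
      apply ha
      ext i
      fin_cases i <;> simp [h0, h1]
    refine ⟨b 1 / a 1, ?_⟩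
    ext i
    fin_cases i
    · have : a 1 * b 0 = 0 := by rw [h0] at h; linarith
      simpa [h0, h1] using this
    · simp [h1]
  · refine ⟨b 0 / a 0, ?_⟩
    ext i
    fin_cases i
    · simp [h0]
    · simp only [PiLp.smul_apply, smul_eq_mul, Fin.mk_one, Fin.isValue]
      field_simp
      linarith

/-- The derivative of `cross` along a pair of curves with values `a`, `b` and derivatives
`A`, `B`. -/
def crossD (a b : Plane) (A B : Plane →L[ℝ] Plane) : Plane →L[ℝ] ℝ :=
  (cross.flip b).comp A + (cross a).comp B

lemma crossD_apply (a b : Plane) (A B : Plane →L[ℝ] Plane) (h : Plane) :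
    crossD a b A B h = cross (A h) b + cross a (B h) := by
  simp [crossD]

lemma crossD_smul (t : ℝ) (a b : Plane) (A B : Plane →L[ℝ] Plane) :
    crossD (t • a) (t • b) A B = t • crossD a b A B := by
  ext h
  simp [crossD_apply, mul_add]

lemma hasFDerivAt_cross {f g : Plane → Plane} {A B : Plane →L[ℝ] Plane} {p : Plane}
    (hf : HasFDerivAt f A p) (hg : HasFDerivAt g B p) :
    HasFDerivAt (fun x => cross (f x) (g x)) (crossD (f p) (g p) A B) p := by
  refine (cross.hasFDerivAt_of_bilinear hf hg).congr_fderiv ?_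
  ext h
  simp [crossD_apply, add_comm]

lemma hasFDerivAt_Q {f g : Plane → Plane} {A B : Plane →L[ℝ] Plane} {p : Plane}
    (hf : HasFDerivAt f A p) (hg : HasFDerivAt g B p) :
    HasFDerivAt (Q f g) (crossD (f p) (g p) A B) p :=
  (hasFDerivAt_cross hf hg).congr_of_eventuallyEq (Eventually.of_forall fun x => Q_eq f g x)

/-- The second derivative of `Q` along a vector field, in terms of the 2-jets `(a, A, A')` and
`(b, B, B')` of the two vector fields. -/
def crossLie (a b : Plane) (A B : Plane →L[ℝ] Plane) (A' B' : Plane →L[ℝ] Plane →L[ℝ] Plane) : ℝ :=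
  cross (A' a a + A (A a)) b + 2 * cross (A a) (B a) + cross a (B' a a + B (A a))

lemma lieDeriv_lieDeriv_Q {f g : Plane → Plane} (hf : ContDiff ℝ 2 f) (hg : ContDiff ℝ 2 g)
    (p : Plane) : lieDeriv f (lieDeriv f (Q f g)) p =
      crossLie (f p) (g p) (fderiv ℝ f p) (fderiv ℝ g p) (fderiv ℝ (fderiv ℝ f) p)
        (fderiv ℝ (fderiv ℝ g) p) := by
  have df : ∀ x, HasFDerivAt f (fderiv ℝ f x) x := fun x =>
    (hf.differentiable two_ne_zero x).hasFDerivAt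
  have dg : ∀ x, HasFDerivAt g (fderiv ℝ g x) x := fun x =>
    (hg.differentiable two_ne_zero x).hasFDerivAt
  have ddf : HasFDerivAt (fderiv ℝ f) (fderiv ℝ (fderiv ℝ f) p) p :=
    ((hf.fderiv_right (m := 1) (by norm_num)).differentiable one_ne_zero p).hasFDerivAt
  have ddg : HasFDerivAt (fderiv ℝ g) (fderiv ℝ (fderiv ℝ g) p) p :=
    ((hg.fderiv_right (m := 1) (by norm_num)).differentiable one_ne_zero p).hasFDerivAt
  have e1 : lieDeriv f (Q f g) =
      fun x => cross (fderiv ℝ f x (f x)) (g x) + cross (f x) (fderiv ℝ g x (f x)) := by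
    funext x
    rw [lieDeriv, (hasFDerivAt_Q (df x) (dg x)).fderiv, crossD_apply]
  have hU := ddf.clm_apply (df p)
  have hV := ddg.clm_apply (df p)
  have h := (hasFDerivAt_cross hU (dg p)).add (hasFDerivAt_cross (df p) hV)
  rw [lieDeriv, e1]
  erw [h.fderiv]
  simp only [crossLie, crossD_apply, _root_.add_apply,
    ContinuousLinearMap.comp_apply, ContinuousLinearMap.flip_apply, map_add]
  ring

/-! ### Convergence of jets along `jetFilter` -/

lemma GASField.contDiff (X : GASField) : ContDiff ℝ ∞ X.1.toFun := X.1.smooth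

lemma GASField.contDiff_two (X : GASField) : ContDiff ℝ 2 X.1.toFun :=
  X.contDiff.of_le (by norm_cast)

lemma GASField.map_zero (X : GASField) : X.1.toFun 0 = 0 := X.2.1

lemma GASField.hasFDerivAt (X : GASField) (p : Plane) :
    HasFDerivAt X.1.toFun (fderiv ℝ X.1.toFun p) p :=
  (X.contDiff_two.differentiable two_ne_zero p).hasFDerivAt

lemma GASField.continuous (X : GASField) : Continuous X.1.toFun := X.contDiff.continuous

lemma GASField.continuous_fderiv (X : GASField) : Continuous (fderiv ℝ X.1.toFun) :=
  X.contDiff_two.continuous_fderiv two_ne_zero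

lemma GASField.continuous_fderiv_fderiv (X : GASField) :
    Continuous (fderiv ℝ (fderiv ℝ X.1.toFun)) :=
  (X.contDiff_two.fderiv_right (m := 1) (by norm_num)).continuous_fderiv one_ne_zero

/-- Continuous dependence on a point and on a perturbation that is uniformly small near the point. -/
lemma tendsto_of_uniform_near {ι E : Type*} [NormedAddCommGroup E] {L : Filter ι} {x : ι → Plane}
    {c y : Plane} (hx : Tendsto x L (𝓝 y)) (hy : y ∈ Metric.ball c 1) {G : Plane → E}
    (hG : Continuous G) {H : ι → Plane → E}
    (hH : ∀ e > 0, ∀ᶠ i in L, ∀ z ∈ Metric.ball c 1, ‖H i z - G z‖ < e) :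
    Tendsto (fun i => H i (x i)) L (𝓝 (G y)) := by
  have h1 : Tendsto (fun i => G (x i)) L (𝓝 (G y)) := (hG.tendsto y).comp hx
  have h2 : Tendsto (fun i => H i (x i) - G (x i)) L (𝓝 0) := by
    rw [Metric.tendsto_nhds]
    intro e he
    filter_upwards [hH e he, hx (Metric.isOpen_ball.mem_nhds hy)] with i hi hxi
    simpa using hi _ hxi
  simpa using h2.add h1

section Tendsto

variable {X Y : GASField} {ι : Type*} {L : Filter ι} {W : ι → GASField × GASField} {c y : Plane}
  {x : ι → Plane}

lemma eventually_pairNear_jetFilter (hW : Tendsto W L (jetFilter X Y c)) {e : ℝ} (he : 0 < e) :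
    ∀ᶠ i in L, ∀ z ∈ Metric.ball c 1, PairNear X Y e z (W i) :=
  hW ((jetFilter_hasBasis X Y c).mem_of_mem he)

lemma tendsto_fst_val (hW : Tendsto W L (jetFilter X Y c)) (hx : Tendsto x L (𝓝 y))
    (hy : y ∈ Metric.ball c 1) :
    Tendsto (fun i => (W i).1.1.toFun (x i)) L (𝓝 (X.1.toFun y)) :=
  tendsto_of_uniform_near (H := fun i => (W i).1.1.toFun) hx hy X.continuous fun _ he =>
    (eventually_pairNear_jetFilter hW he).mono fun _ h z hz => (h z hz).1.1

lemma tendsto_snd_val (hW : Tendsto W L (jetFilter X Y c)) (hx : Tendsto x L (𝓝 y))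
    (hy : y ∈ Metric.ball c 1) :
    Tendsto (fun i => (W i).2.1.toFun (x i)) L (𝓝 (Y.1.toFun y)) :=
  tendsto_of_uniform_near (H := fun i => (W i).2.1.toFun) hx hy Y.continuous fun _ he =>
    (eventually_pairNear_jetFilter hW he).mono fun _ h z hz => (h z hz).2.1

lemma tendsto_fst_fderiv (hW : Tendsto W L (jetFilter X Y c)) (hx : Tendsto x L (𝓝 y))
    (hy : y ∈ Metric.ball c 1) :
    Tendsto (fun i => fderiv ℝ (W i).1.1.toFun (x i)) L (𝓝 (fderiv ℝ X.1.toFun y)) :=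
  tendsto_of_uniform_near (H := fun i => fderiv ℝ (W i).1.1.toFun) hx hy X.continuous_fderiv
    fun _ he => (eventually_pairNear_jetFilter hW he).mono fun _ h z hz => (h z hz).1.2.1

lemma tendsto_snd_fderiv (hW : Tendsto W L (jetFilter X Y c)) (hx : Tendsto x L (𝓝 y))
    (hy : y ∈ Metric.ball c 1) :
    Tendsto (fun i => fderiv ℝ (W i).2.1.toFun (x i)) L (𝓝 (fderiv ℝ Y.1.toFun y)) :=
  tendsto_of_uniform_near (H := fun i => fderiv ℝ (W i).2.1.toFun) hx hy Y.continuous_fderiv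
    fun _ he => (eventually_pairNear_jetFilter hW he).mono fun _ h z hz => (h z hz).2.2.1

lemma tendsto_fst_fderiv_fderiv (hW : Tendsto W L (jetFilter X Y c)) (hx : Tendsto x L (𝓝 y))
    (hy : y ∈ Metric.ball c 1) :
    Tendsto (fun i => fderiv ℝ (fderiv ℝ (W i).1.1.toFun) (x i)) L
      (𝓝 (fderiv ℝ (fderiv ℝ X.1.toFun) y)) :=
  tendsto_of_uniform_near (H := fun i => fderiv ℝ (fderiv ℝ (W i).1.1.toFun)) hx hy
    X.continuous_fderiv_fderiv
    fun _ he => (eventually_pairNear_jetFilter hW he).mono fun _ h z hz => (h z hz).1.2.2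

lemma tendsto_snd_fderiv_fderiv (hW : Tendsto W L (jetFilter X Y c)) (hx : Tendsto x L (𝓝 y))
    (hy : y ∈ Metric.ball c 1) :
    Tendsto (fun i => fderiv ℝ (fderiv ℝ (W i).2.1.toFun) (x i)) L
      (𝓝 (fderiv ℝ (fderiv ℝ Y.1.toFun) y)) :=
  tendsto_of_uniform_near (H := fun i => fderiv ℝ (fderiv ℝ (W i).2.1.toFun)) hx hy
    Y.continuous_fderiv_fderiv
    fun _ he => (eventually_pairNear_jetFilter hW he).mono fun _ h z hz => (h z hz).2.2.2

lemma tendsto_clm_apply {E F : Type*} [NormedAddCommGroup E] [NormedSpace ℝ E]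
    [NormedAddCommGroup F] [NormedSpace ℝ F] {A : ι → E →L[ℝ] F} {a : ι → E} {A₀ : E →L[ℝ] F}
    {a₀ : E} (hA : Tendsto A L (𝓝 A₀)) (ha : Tendsto a L (𝓝 a₀)) :
    Tendsto (fun i => A i (a i)) L (𝓝 (A₀ a₀)) :=
  ((isBoundedBilinearMap_apply (𝕜 := ℝ) (E := E) (F := F)).continuous.tendsto (A₀, a₀)).comp
    (hA.prodMk_nhds ha)

lemma tendsto_cross {a b : ι → Plane} {a₀ b₀ : Plane} (ha : Tendsto a L (𝓝 a₀))
    (hb : Tendsto b L (𝓝 b₀)) : Tendsto (fun i => cross (a i) (b i)) L (𝓝 (cross a₀ b₀)) :=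
  tendsto_clm_apply ((cross.continuous.tendsto a₀).comp ha) hb

lemma tendsto_clm_comp {E F G : Type*} [NormedAddCommGroup E] [NormedSpace ℝ E]
    [NormedAddCommGroup F] [NormedSpace ℝ F] [NormedAddCommGroup G] [NormedSpace ℝ G]
    {A : ι → F →L[ℝ] G} {B : ι → E →L[ℝ] F} {A₀ : F →L[ℝ] G} {B₀ : E →L[ℝ] F}
    (hA : Tendsto A L (𝓝 A₀)) (hB : Tendsto B L (𝓝 B₀)) :
    Tendsto (fun i => (A i).comp (B i)) L (𝓝 (A₀.comp B₀)) :=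
  ((isBoundedBilinearMap_comp (𝕜 := ℝ) (E := E) (F := F) (G := G)).continuous.tendsto
    (A₀, B₀)).comp (hA.prodMk_nhds hB)

lemma tendsto_crossD {a b : ι → Plane} {a₀ b₀ : Plane} {A B : ι → Plane →L[ℝ] Plane}
    {A₀ B₀ : Plane →L[ℝ] Plane} (ha : Tendsto a L (𝓝 a₀)) (hb : Tendsto b L (𝓝 b₀))
    (hA : Tendsto A L (𝓝 A₀)) (hB : Tendsto B L (𝓝 B₀)) :
    Tendsto (fun i => crossD (a i) (b i) (A i) (B i)) L (𝓝 (crossD a₀ b₀ A₀ B₀)) :=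
  (tendsto_clm_comp ((cross.flip.continuous.tendsto b₀).comp hb) hA).add
    (tendsto_clm_comp ((cross.continuous.tendsto a₀).comp ha) hB)

/-- The differential of `Q`, in terms of the 1-jets of the two fields. -/
def dQ (W : GASField × GASField) (p : Plane) : Plane →L[ℝ] ℝ :=
  crossD (W.1.1.toFun p) (W.2.1.toFun p) (fderiv ℝ W.1.1.toFun p) (fderiv ℝ W.2.1.toFun p)

lemma hasFDerivAt_Q_pair (W : GASField × GASField) (p : Plane) :
    HasFDerivAt (Q W.1.1.toFun W.2.1.toFun) (dQ W p) p :=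
  hasFDerivAt_Q (W.1.hasFDerivAt p) (W.2.hasFDerivAt p)

lemma continuous_Q_pair (W : GASField × GASField) : Continuous (Q W.1.1.toFun W.2.1.toFun) :=
  continuous_iff_continuousAt.2 fun p => (hasFDerivAt_Q_pair W p).continuousAt

lemma tendsto_Q (hW : Tendsto W L (jetFilter X Y c)) (hx : Tendsto x L (𝓝 y))
    (hy : y ∈ Metric.ball c 1) :
    Tendsto (fun i => Q (W i).1.1.toFun (W i).2.1.toFun (x i)) L
      (𝓝 (Q X.1.toFun Y.1.toFun y)) := by
  simp only [Q_eq]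
  exact tendsto_cross (tendsto_fst_val hW hx hy) (tendsto_snd_val hW hx hy)

lemma tendsto_dQ (hW : Tendsto W L (jetFilter X Y c)) (hx : Tendsto x L (𝓝 y))
    (hy : y ∈ Metric.ball c 1) :
    Tendsto (fun i => dQ (W i) (x i)) L (𝓝 (dQ (X, Y) y)) :=
  tendsto_crossD (tendsto_fst_val hW hx hy) (tendsto_snd_val hW hx hy)
    (tendsto_fst_fderiv hW hx hy) (tendsto_snd_fderiv hW hx hy)

lemma tendsto_lieDeriv_lieDeriv_Q (hW : Tendsto W L (jetFilter X Y c)) (hx : Tendsto x L (𝓝 y))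
    (hy : y ∈ Metric.ball c 1) :
    Tendsto (fun i => lieDeriv (W i).1.1.toFun (lieDeriv (W i).1.1.toFun
      (Q (W i).1.1.toFun (W i).2.1.toFun)) (x i)) L
      (𝓝 (lieDeriv X.1.toFun (lieDeriv X.1.toFun (Q X.1.toFun Y.1.toFun)) y)) := by
  simp only [lieDeriv_lieDeriv_Q (GASField.contDiff_two _) (GASField.contDiff_two _)]
  have ha := tendsto_fst_val hW hx hy
  have hb := tendsto_snd_val hW hx hy
  have hA := tendsto_fst_fderiv hW hx hy
  have hB := tendsto_snd_fderiv hW hx hy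
  have hA' := tendsto_fst_fderiv_fderiv hW hx hy
  have hB' := tendsto_snd_fderiv_fderiv hW hx hy
  have hAa := tendsto_clm_apply hA ha
  have hA'a := tendsto_clm_apply (tendsto_clm_apply hA' ha) ha
  have hB'a := tendsto_clm_apply (tendsto_clm_apply hB' ha) ha
  exact ((tendsto_cross (hA'a.add (tendsto_clm_apply hA hAa)) hb).add
    ((tendsto_cross hAa (tendsto_clm_apply hB ha)).const_mul 2)).add
      (tendsto_cross ha (hB'a.add (tendsto_clm_apply hB hAa)))

/-! ### Blow-up at the origin -/

/-- A function vanishing at the origin whose derivative is uniformly close to `A` near the origin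
is, after rescaling by `t⁻¹`, close to the linear map `A`. -/
lemma tendsto_rescale {H : ι → Plane → Plane} {A : Plane →L[ℝ] Plane} {t : ι → ℝ} {v : Plane}
    (h0 : ∀ i, H i 0 = 0) (hd : ∀ i, Differentiable ℝ (H i))
    (hA : ∀ e > 0, ∃ d > 0, ∀ᶠ i in L, ∀ z ∈ Metric.ball (0 : Plane) d, ‖fderiv ℝ (H i) z - A‖ ≤ e)
    (ht : Tendsto t L (𝓝[>] 0)) (hx : Tendsto x L (𝓝 v)) :
    Tendsto (fun i => (t i)⁻¹ • H i (t i • x i)) L (𝓝 (A v)) := by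
  have ht0 : Tendsto t L (𝓝 0) := ht.mono_right nhdsWithin_le_nhds
  have htx : Tendsto (fun i => t i • x i) L (𝓝 0) := by simpa using ht0.smul hx
  have hAx : Tendsto (fun i => A (x i)) L (𝓝 (A v)) := (A.continuous.tendsto v).comp hx
  have hdiff : Tendsto (fun i => (t i)⁻¹ • H i (t i • x i) - A (x i)) L (𝓝 0) := by
    rw [Metric.tendsto_nhds]
    intro e he
    obtain ⟨d, hdpos, hev⟩ := hA (e / (2 * (‖v‖ + 1))) (by positivity)
    filter_upwards [hev, htx (Metric.ball_mem_nhds 0 hdpos), ht self_mem_nhdsWithin,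
      hx.norm.eventually (gt_mem_nhds (lt_add_one ‖v‖))] with i hi hb hti hxi
    have htpos : 0 < t i := hti
    have hm := (convex_ball (0 : Plane) d).norm_image_sub_le_of_norm_fderiv_le' (𝕜 := ℝ)
      (fun z _ => (hd i) z) hi (Metric.mem_ball_self hdpos) hb
    simp only [h0, sub_zero, map_smul] at hm
    have e1 : (t i)⁻¹ • H i (t i • x i) - A (x i) = (t i)⁻¹ • (H i (t i • x i) - t i • A (x i)) := by
      rw [smul_sub, inv_smul_smul₀ htpos.ne']
    rw [dist_zero_right, e1, norm_smul, norm_inv, Real.norm_of_nonneg htpos.le, inv_mul_lt_iff₀ htpos]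
    refine hm.trans_lt ?_
    rw [norm_smul, Real.norm_of_nonneg htpos.le]
    have h2 : e / (2 * (‖v‖ + 1)) * (‖v‖ + 1) = e / 2 := by
      field_simp
    calc e / (2 * (‖v‖ + 1)) * (t i * ‖x i‖)
        ≤ e / (2 * (‖v‖ + 1)) * (t i * (‖v‖ + 1)) := by gcongr
      _ = t i * (e / 2) := by rw [← h2]; ring
      _ < t i * e := by gcongr; linarith
  simpa using hdiff.add hAx

lemma exists_ball_norm_sub_le {G : Plane → Plane →L[ℝ] Plane} (hG : Continuous G) {e : ℝ}
    (he : 0 < e) : ∃ d > 0, d ≤ 1 ∧ ∀ z ∈ Metric.ball (0 : Plane) d, ‖G z - G 0‖ ≤ e := by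
  obtain ⟨d, hd, h⟩ := Metric.continuousAt_iff.1 (hG.continuousAt (x := 0)) e he
  exact ⟨min d 1, by positivity, min_le_right _ _, fun z hz => by
    rw [← dist_eq_norm]
    exact (h (hz.trans_le (min_le_left _ _))).le⟩

lemma tendsto_fst_rescale {t : ι → ℝ} {v : Plane} (hW : Tendsto W L (jetFilter X Y 0))
    (ht : Tendsto t L (𝓝[>] 0)) (hx : Tendsto x L (𝓝 v)) :
    Tendsto (fun i => (t i)⁻¹ • (W i).1.1.toFun (t i • x i)) L (𝓝 (fderiv ℝ X.1.toFun 0 v)) := by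
  refine tendsto_rescale (fun i => (W i).1.map_zero)
    (fun i => (W i).1.contDiff_two.differentiable two_ne_zero) (fun e he => ?_) ht hx
  obtain ⟨d, hd, hd1, h⟩ := exists_ball_norm_sub_le X.continuous_fderiv (half_pos he)
  refine ⟨d, hd, (eventually_pairNear_jetFilter hW (half_pos he)).mono fun i hi z hz => ?_⟩
  have h1 := (hi z (Metric.ball_subset_ball hd1 hz)).1.2.1
  have h2 := norm_sub_le_norm_sub_add_norm_sub (fderiv ℝ (W i).1.1.toFun z)
    (fderiv ℝ X.1.toFun z) (fderiv ℝ X.1.toFun 0)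
  linarith [h z hz]

lemma tendsto_snd_rescale {t : ι → ℝ} {v : Plane} (hW : Tendsto W L (jetFilter X Y 0))
    (ht : Tendsto t L (𝓝[>] 0)) (hx : Tendsto x L (𝓝 v)) :
    Tendsto (fun i => (t i)⁻¹ • (W i).2.1.toFun (t i • x i)) L (𝓝 (fderiv ℝ Y.1.toFun 0 v)) := by
  refine tendsto_rescale (fun i => (W i).2.map_zero)
    (fun i => (W i).2.contDiff_two.differentiable two_ne_zero) (fun e he => ?_) ht hx
  obtain ⟨d, hd, hd1, h⟩ := exists_ball_norm_sub_le Y.continuous_fderiv (half_pos he)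
  refine ⟨d, hd, (eventually_pairNear_jetFilter hW (half_pos he)).mono fun i hi z hz => ?_⟩
  have h1 := (hi z (Metric.ball_subset_ball hd1 hz)).2.2.1
  have h2 := norm_sub_le_norm_sub_add_norm_sub (fderiv ℝ (W i).2.1.toFun z)
    (fderiv ℝ Y.1.toFun z) (fderiv ℝ Y.1.toFun 0)
  linarith [h z hz]

/-- The quadratic part of `Q` at the origin (half of its Hessian). -/
def quadQ (X Y : GASField) (v : Plane) : ℝ :=
  cross (fderiv ℝ X.1.toFun 0 v) (fderiv ℝ Y.1.toFun 0 v)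

/-- The Hessian of `Q` at the origin: `hessQ X Y v` is the derivative of `quadQ X Y` at `v`. -/
def hessQ (X Y : GASField) (v : Plane) : Plane →L[ℝ] ℝ :=
  crossD (fderiv ℝ X.1.toFun 0 v) (fderiv ℝ Y.1.toFun 0 v) (fderiv ℝ X.1.toFun 0)
    (fderiv ℝ Y.1.toFun 0)

lemma tendsto_smul_zero {t : ι → ℝ} {v : Plane} (ht : Tendsto t L (𝓝[>] 0))
    (hx : Tendsto x L (𝓝 v)) : Tendsto (fun i => t i • x i) L (𝓝 0) := by
  simpa using (ht.mono_right nhdsWithin_le_nhds).smul hx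

lemma tendsto_Q_rescale {t : ι → ℝ} {v : Plane} (hW : Tendsto W L (jetFilter X Y 0))
    (ht : Tendsto t L (𝓝[>] 0)) (hx : Tendsto x L (𝓝 v)) :
    Tendsto (fun i => (t i ^ 2)⁻¹ * Q (W i).1.1.toFun (W i).2.1.toFun (t i • x i)) L
      (𝓝 (quadQ X Y v)) := by
  refine (tendsto_cross (tendsto_fst_rescale hW ht hx) (tendsto_snd_rescale hW ht hx)).congr
    fun i => ?_
  simp only [Q_eq, map_smul, _root_.smul_apply, smul_eq_mul]
  ring

lemma tendsto_dQ_rescale {t : ι → ℝ} {v : Plane} (hW : Tendsto W L (jetFilter X Y 0))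
    (ht : Tendsto t L (𝓝[>] 0)) (hx : Tendsto x L (𝓝 v)) :
    Tendsto (fun i => (t i)⁻¹ • dQ (W i) (t i • x i)) L (𝓝 (hessQ X Y v)) := by
  have h0 := tendsto_smul_zero ht hx
  refine (tendsto_crossD (tendsto_fst_rescale hW ht hx) (tendsto_snd_rescale hW ht hx)
    (tendsto_fst_fderiv hW h0 (Metric.mem_ball_self one_pos))
    (tendsto_snd_fderiv hW h0 (Metric.mem_ball_self one_pos))).congr fun i => ?_
  rw [crossD_smul, dQ]

end Tendsto

/-- To prove a property near the origin, it suffices to prove it along all rescaled directions. -/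
lemma eventually_punctured_of_directions {α : Type*} {L : Filter α} {P : α → Plane → Prop}
    (h : ∀ v ∈ Metric.sphere (0 : Plane) 1,
      ∀ᶠ z in L ×ˢ (𝓝[>] (0 : ℝ) ×ˢ 𝓝 v), P z.1 (z.2.1 • z.2.2)) :
    ∀ᶠ z in L ×ˢ 𝓝[≠] (0 : Plane), P z.1 z.2 := by
  have hK : ∀ᶠ z in L ×ˢ 𝓝[>] (0 : ℝ), ∀ v ∈ Metric.sphere (0 : Plane) 1, P z.1 (z.2 • v) := by
    refine (isCompact_sphere (0 : Plane) 1).induction_on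
      (p := fun K => ∀ᶠ z in L ×ˢ 𝓝[>] (0 : ℝ), ∀ v ∈ K, P z.1 (z.2 • v)) ?_ ?_ ?_ ?_
    · simp
    · intro K K' hKK ih
      exact ih.mono fun z hz v hv => hz v (hKK hv)
    · intro K K' ih ih'
      filter_upwards [ih, ih'] with z hz hz' v hv
      exact hv.elim (hz v) (hz' v)
    · intro v hv
      obtain ⟨S, hS, U, hU, hSU⟩ := mem_prod_iff.1 (h v hv)
      obtain ⟨T, hT, V, hV, hTV⟩ := mem_prod_iff.1 hU
      refine ⟨V, mem_nhdsWithin_of_mem_nhds hV, ?_⟩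
      filter_upwards [prod_mem_prod hS hT] with z hz w hw
      exact @hSU (z.1, (z.2, w)) ⟨hz.1, hTV ⟨hz.2, hw⟩⟩
  have hn : Tendsto (fun z : α × Plane => (z.1, ‖z.2‖)) (L ×ˢ 𝓝[≠] (0 : Plane))
      (L ×ˢ 𝓝[>] (0 : ℝ)) := tendsto_fst.prodMk (tendsto_norm_nhdsNE_zero.comp tendsto_snd)
  have hne : ∀ᶠ z in L ×ˢ 𝓝[≠] (0 : Plane), z.2 ≠ 0 :=
    tendsto_snd.eventually (eventually_mem_of_tendsto_nhdsWithin tendsto_id)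
  filter_upwards [hn.eventually hK, hne] with z hz hz0
  have h1 := hz (‖z.2‖⁻¹ • z.2) (by
    rw [mem_sphere_zero_iff_norm, norm_smul, norm_inv, norm_norm,
      inv_mul_cancel₀ (norm_ne_zero_iff.2 hz0)])
  simpa [smul_smul, norm_ne_zero_iff.2 hz0] using h1

/-! ### Grönwall's inequality in integral form -/

lemma le_gronwallBound_of_integral_le {w : ℝ → ℝ} {a b K T : ℝ} (ha : 0 ≤ a) (hb : 0 ≤ b)
    (hK : 0 ≤ K) (hwc : ContinuousOn w (Icc 0 T)) (hw0 : ∀ t ∈ Icc 0 T, 0 ≤ w t)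
    (hw : ∀ t ∈ Icc 0 T, w t ≤ a + ∫ s in (0 : ℝ)..t, (K * w s + b)) :
    ∀ t ∈ Icc 0 T, w t ≤ gronwallBound a K b t := by
  intro t₀ ht₀
  have hT : 0 ≤ T := ht₀.1.trans ht₀.2
  -- Extending `w` continuously to the line makes the integral differentiable everywhere.
  set w' : ℝ → ℝ := IccExtend hT ((Icc 0 T).domRestrict w) with hw'
  have hc : Continuous w' := (continuousOn_iff_continuous_domRestrict.1 hwc).Icc_extend'
  have heq : ∀ s ∈ Icc 0 T, w' s = w s := fun s hs => by
    rw [hw', IccExtend_of_mem _ _ hs]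
    rfl
  have hc2 : Continuous fun s => K * w' s + b := by fun_prop
  set V : ℝ → ℝ := fun t => a + ∫ s in (0 : ℝ)..t, (K * w' s + b) with hV
  have hVd : ∀ t, HasDerivAt V (K * w' t + b) t := fun t =>
    (intervalIntegral.integral_hasDerivAt_right (hc2.intervalIntegrable _ _)
      (hc2.stronglyMeasurableAtFilter _ _) hc2.continuousAt).const_add a
  have hint : ∀ t ∈ Icc 0 T, ∫ s in (0 : ℝ)..t, (K * w' s + b) = ∫ s in (0 : ℝ)..t, (K * w s + b) := by
    intro t ht
    refine intervalIntegral.integral_congr fun s hs => ?_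
    rw [uIcc_of_le ht.1] at hs
    simp only [heq s ⟨hs.1, hs.2.trans ht.2⟩]
  have hwV : ∀ t ∈ Icc 0 T, w t ≤ V t := fun t ht => by
    rw [hV]
    simp only [hint t ht]
    exact hw t ht
  have hbound := norm_le_gronwallBound_of_norm_deriv_right_le (f := V)
    (f' := fun t => K * w' t + b) (δ := a) (K := K) (ε := b) (a := 0) (b := T)
    (fun t _ => (hVd t).continuousAt.continuousWithinAt) (fun t _ => (hVd t).hasDerivWithinAt)
    (by simp [hV, abs_of_nonneg ha]) (fun t ht => by
      have ht' : t ∈ Icc 0 T := ⟨ht.1, ht.2.le⟩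
      have h0 := hw0 t ht'
      have h1 := hwV t ht'
      simp only [heq t ht']
      rw [Real.norm_of_nonneg (by positivity), Real.norm_of_nonneg (h0.trans h1)]
      gcongr)
  have := hbound t₀ ht₀
  rw [sub_zero] at this
  exact (hwV t₀ ht₀).trans ((le_abs_self _).trans this)

/-- A globally asymptotically stable field has no zero besides the origin: a constant trajectory
is the only one issued from a zero, and it does not converge to the origin. -/
lemma GASField.ne_zero (X : GASField) {p : Plane} (hp : p ≠ 0) : X.1.toFun p ≠ 0 := by
  intro h0
  obtain ⟨γ, hγ, hlim⟩ := X.2.2.2 (fun _ => 0) ⟨measurable_const, fun _ => rfl⟩ p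
  have hconst : ∀ T ≥ 0, γ T = p := by
    intro T hT
    obtain ⟨hc, hi, he⟩ := hγ T hT
    obtain ⟨R, hR⟩ := ((isCompact_Icc.image_of_continuousOn hc).isBounded.union
      (Bornology.isBounded_singleton (x := p))).subset_closedBall 0
    obtain ⟨K, hK⟩ := (X.contDiff_two.contDiffOn (s := Metric.closedBall 0 R)).exists_lipschitzOnWith
      two_ne_zero (convex_closedBall 0 R) (isCompact_closedBall 0 R)
    have hpR : p ∈ Metric.closedBall 0 R := hR (Or.inr rfl)
    have hX : ∀ s ∈ Icc 0 T, ‖X.1.toFun (γ s)‖ ≤ K * ‖γ s - p‖ := by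
      intro s hs
      have := hK.dist_le_mul (γ s) (hR (Or.inl ⟨s, hs, rfl⟩)) p hpR
      rwa [h0, dist_zero_right, dist_eq_norm] at this
    have hwc : ContinuousOn (fun s => ‖γ s - p‖) (Icc 0 T) := (hc.sub continuousOn_const).norm
    have hg := le_gronwallBound_of_integral_le (w := fun s => ‖γ s - p‖) (a := 0) (b := 0)
      (K := K) (T := T) le_rfl le_rfl K.2 hwc (fun _ _ => norm_nonneg _) (fun t ht => by
        have h1 : γ t - p = ∫ s in (0 : ℝ)..t, X.1.toFun (γ s) := by
          conv_lhs => rw [he t ht]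
          simp
        rw [h1, zero_add]
        refine intervalIntegral.norm_integral_le_of_norm_le ht.1
          (Eventually.of_forall fun s hs => ?_) ?_
        · rw [add_zero]
          exact hX s ⟨hs.1.le, hs.2.trans ht.2⟩
        · refine ContinuousOn.intervalIntegrable ?_
          rw [uIcc_of_le ht.1]
          exact ((hwc.mono (Icc_subset_Icc le_rfl ht.2)).const_smul (K : ℝ)).add continuousOn_const)
      T ⟨hT, le_rfl⟩
    rw [gronwallBound_ε0, zero_mul] at hg
    exact sub_eq_zero.1 (norm_le_zero_iff.1 hg)
  have : Tendsto γ atTop (𝓝 p) :=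
    tendsto_const_nhds.congr' (by
      filter_upwards [eventually_ge_atTop 0] with T hT
      exact (hconst T hT).symm)
  exact hp (tendsto_nhds_unique this hlim)

/-! ### The Hessian of `Q` at the origin -/

section Hessian

variable (X Y : GASField)

lemma hessQ_apply (v w : Plane) :
    hessQ X Y v w = cross (fderiv ℝ X.1.toFun 0 w) (fderiv ℝ Y.1.toFun 0 v) +
      cross (fderiv ℝ X.1.toFun 0 v) (fderiv ℝ Y.1.toFun 0 w) := crossD_apply _ _ _ _ _

lemma hessQ_comm (v w : Plane) : hessQ X Y v w = hessQ X Y w v := by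
  rw [hessQ_apply, hessQ_apply]; ring

lemma hessQ_self (v : Plane) : hessQ X Y v v = 2 * quadQ X Y v := by
  rw [hessQ_apply, quadQ]; ring

lemma quadQ_add_smul (v w : Plane) (s : ℝ) :
    quadQ X Y (v + s • w) = quadQ X Y v + s * hessQ X Y v w + s ^ 2 * quadQ X Y w := by
  rw [hessQ_apply]
  simp only [quadQ, map_add, map_smul, _root_.add_apply, _root_.smul_apply, smul_eq_mul]
  ring

lemma pderiv_pderiv_Q_zero (i j : Fin 2) :
    pderiv i (pderiv j (Q X.1.toFun Y.1.toFun)) 0 =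
      hessQ X Y (EuclideanSpace.single i 1) (EuclideanSpace.single j 1) := by
  have dX : HasFDerivAt (fderiv ℝ X.1.toFun) (fderiv ℝ (fderiv ℝ X.1.toFun) 0) 0 :=
    ((X.contDiff_two.fderiv_right (m := 1) (by norm_num)).differentiable
      one_ne_zero 0).hasFDerivAt
  have dY : HasFDerivAt (fderiv ℝ Y.1.toFun) (fderiv ℝ (fderiv ℝ Y.1.toFun) 0) 0 :=
    ((Y.contDiff_two.fderiv_right (m := 1) (by norm_num)).differentiable
      one_ne_zero 0).hasFDerivAt
  have e1 : pderiv j (Q X.1.toFun Y.1.toFun) = fun x =>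
      cross (fderiv ℝ X.1.toFun x (EuclideanSpace.single j 1)) (Y.1.toFun x) +
        cross (X.1.toFun x) (fderiv ℝ Y.1.toFun x (EuclideanSpace.single j 1)) := by
    funext x
    rw [pderiv, (hasFDerivAt_Q_pair (X, Y) x).fderiv, dQ, crossD_apply]
  have hU := dX.clm_apply (hasFDerivAt_const (EuclideanSpace.single j (1 : ℝ)) (0 : Plane))
  have hV := dY.clm_apply (hasFDerivAt_const (EuclideanSpace.single j (1 : ℝ)) (0 : Plane))
  have h := (hasFDerivAt_cross hU (Y.hasFDerivAt 0)).add (hasFDerivAt_cross (X.hasFDerivAt 0) hV)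
  rw [pderiv, e1]
  erw [h.fderiv]
  simp only [crossD_apply, _root_.add_apply, hessQ_apply, X.map_zero, Y.map_zero, map_zero,
    _root_.zero_apply, add_zero, zero_add]

lemma G2_iff : G2 X.1.toFun Y.1.toFun ↔
    hessQ X Y (EuclideanSpace.single 0 1) (EuclideanSpace.single 0 1) *
        hessQ X Y (EuclideanSpace.single 1 1) (EuclideanSpace.single 1 1) -
      hessQ X Y (EuclideanSpace.single 0 1) (EuclideanSpace.single 1 1) *
        hessQ X Y (EuclideanSpace.single 1 1) (EuclideanSpace.single 0 1) ≠ 0 := by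
  rw [G2, Matrix.det_fin_two]
  simp only [Matrix.of_apply, pderiv_pderiv_Q_zero]

variable {X Y}

lemma hessQ_ne_zero (h2 : G2 X.1.toFun Y.1.toFun) {v : Plane} (hv : v ≠ 0) : hessQ X Y v ≠ 0 := by
  intro h
  rw [G2_iff] at h2
  have hlin : ∀ w, v 0 * hessQ X Y (EuclideanSpace.single 0 1) w +
      v 1 * hessQ X Y (EuclideanSpace.single 1 1) w = 0 := by
    intro w
    have := congrArg (hessQ X Y w) (plane_eq_sum v)
    rw [map_add, map_smul, map_smul, hessQ_comm, h] at this
    rw [hessQ_comm X Y _ w, hessQ_comm X Y _ w]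
    simpa using this.symm
  have h0 := hlin (EuclideanSpace.single 0 1)
  have h1 := hlin (EuclideanSpace.single 1 1)
  have a0 : v 0 = 0 := by
    refine (mul_eq_zero.1 ?_).resolve_right h2
    linear_combination hessQ X Y (EuclideanSpace.single 1 1) (EuclideanSpace.single 1 1) * h0 -
      hessQ X Y (EuclideanSpace.single 1 1) (EuclideanSpace.single 0 1) * h1
  have a1 : v 1 = 0 := by
    refine (mul_eq_zero.1 ?_).resolve_right h2
    linear_combination hessQ X Y (EuclideanSpace.single 0 1) (EuclideanSpace.single 0 1) * h1 -
      hessQ X Y (EuclideanSpace.single 0 1) (EuclideanSpace.single 1 1) * h0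
  exact hv (by rw [plane_eq_sum v, a0, a1]; simp)

lemma exists_zero_of_mul_neg {f : ℝ → ℝ} (hf : Continuous f) {a b : ℝ} (h : f a * f b < 0) :
    ∃ c ∈ uIcc a b, f c = 0 := by
  refine intermediate_value_uIcc hf.continuousOn ?_
  rcases mul_neg_iff.1 h with h | h
  · exact Icc_subset_uIcc' ⟨h.2.le, h.1.le⟩
  · exact Icc_subset_uIcc ⟨h.1.le, h.2.le⟩

lemma tendsto_const_jetFilter {ι : Type*} (L : Filter ι) (c : Plane) :
    Tendsto (fun _ : ι => (X, Y)) L (jetFilter X Y c) :=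
  tendsto_const_nhds.mono_right (nhds_le_jetFilter X Y c)

/-- If the Hessian is non-degenerate and the origin is isolated in `Z`, then the Hessian is
definite: along an isotropic direction `Q` would change sign, at all small scales. -/
lemma quadQ_ne_zero (h2 : G2 X.1.toFun Y.1.toFun)
    (hiso : ∀ᶠ p in 𝓝[≠] (0 : Plane), p ∉ Z X.1.toFun Y.1.toFun) {v : Plane} (hv : v ≠ 0) :
    quadQ X Y v ≠ 0 := by
  intro h0
  obtain ⟨n, hn⟩ : ∃ n, hessQ X Y v n ≠ 0 := by
    by_contra! hcon
    exact hessQ_ne_zero h2 hv (ContinuousLinearMap.ext hcon)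
  have hline : ∀ s : ℝ, v + s • n ≠ 0 := by
    intro s hs
    have h1 : hessQ X Y v (v + s • n) = s * hessQ X Y v n := by
      rw [map_add, hessQ_self, h0, map_smul, smul_eq_mul]; ring
    rw [hs, map_zero, zero_eq_mul] at h1
    rw [h1.resolve_right hn] at hs
    exact hv (by simpa using hs)
  set H := hessQ X Y v n with hH
  set q := quadQ X Y n with hq
  obtain ⟨s, hs, hs2⟩ : ∃ s > 0, s ^ 2 * q ^ 2 < H ^ 2 := by
    have hc : Continuous fun s : ℝ => s ^ 2 * q ^ 2 := by fun_prop
    have ht : Tendsto (fun s : ℝ => s ^ 2 * q ^ 2) (𝓝[>] 0) (𝓝 0) := by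
      simpa using (hc.tendsto 0).mono_left nhdsWithin_le_nhds
    obtain ⟨s, hs, hs'⟩ := ((ht.eventually (gt_mem_nhds (sq_pos_of_ne_zero hn : 0 < H ^ 2))).and
      self_mem_nhdsWithin).exists
    exact ⟨s, hs', hs⟩
  have hval : ∀ r, quadQ X Y (v + r • n) = r * H + r ^ 2 * q := fun r => by
    rw [quadQ_add_smul, h0, zero_add]
  have hneg : quadQ X Y (v + (-s) • n) * quadQ X Y (v + s • n) < 0 := by
    rw [hval, hval]
    have : (-s * H + (-s) ^ 2 * q) * (s * H + s ^ 2 * q) = -(s ^ 2 * (H ^ 2 - s ^ 2 * q ^ 2)) := by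
      ring
    rw [this]
    have := mul_pos (pow_pos hs 2) (sub_pos.2 hs2)
    linarith
  have hid : Tendsto (fun t : ℝ => t) (𝓝[>] 0) (𝓝[>] 0) := tendsto_id
  have hlim := (tendsto_Q_rescale (tendsto_const_jetFilter (X := X) (Y := Y) _ 0) hid
    (tendsto_const_nhds (x := v + (-s) • n))).mul
    (tendsto_Q_rescale (tendsto_const_jetFilter (X := X) (Y := Y) _ 0) hid
      (tendsto_const_nhds (x := v + s • n)))
  have hsign := hlim.eventually (gt_mem_nhds hneg)
  rw [eventually_nhdsWithin_iff, Metric.eventually_nhds_iff] at hiso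
  obtain ⟨ρ, hρ, hiso⟩ := hiso
  have hsmall : ∀ᶠ t : ℝ in 𝓝[>] 0, t * (‖v‖ + s * ‖n‖) < ρ := by
    have hc : Continuous fun t : ℝ => t * (‖v‖ + s * ‖n‖) := by fun_prop
    have ht : Tendsto (fun t : ℝ => t * (‖v‖ + s * ‖n‖)) (𝓝[>] 0) (𝓝 0) := by
      simpa using (hc.tendsto 0).mono_left nhdsWithin_le_nhds
    exact ht.eventually (gt_mem_nhds hρ)
  obtain ⟨t, ⟨hts, htr⟩, htp⟩ := ((hsign.and hsmall).and self_mem_nhdsWithin).exists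
  have ht0 : 0 < t := htp
  have hcont : Continuous fun r : ℝ => Q X.1.toFun Y.1.toFun (t • (v + r • n)) :=
    (continuous_Q_pair (X, Y)).comp (by fun_prop)
  obtain ⟨r, hr, hQ⟩ := exists_zero_of_mul_neg (a := -s) (b := s) hcont (by
    have e : ∀ a b : ℝ, (t ^ 2)⁻¹ * a * ((t ^ 2)⁻¹ * b) = ((t ^ 2)⁻¹) ^ 2 * (a * b) := by
      intros; ring
    rw [e] at hts
    exact neg_of_mul_neg_right hts (by positivity))
  refine hiso (y := t • (v + r • n)) ?_ (smul_ne_zero ht0.ne' (hline r)) hQ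
  rw [uIcc_of_le (by linarith)] at hr
  have hrs : |r| ≤ s := abs_le.2 hr
  rw [dist_zero_right, norm_smul, Real.norm_of_nonneg ht0.le]
  calc t * ‖v + r • n‖ ≤ t * (‖v‖ + |r| * ‖n‖) := by
        gcongr
        refine (norm_add_le _ _).trans ?_
        rw [norm_smul, Real.norm_eq_abs]
    _ ≤ t * (‖v‖ + s * ‖n‖) := by gcongr
    _ < ρ := htr

end Hessian

/-! ### Local persistence of the generic conditions -/

lemma eventually_prod_nhds_of_punctured {α : Type*} {L : Filter α} {P : α → Plane → Prop}
    (h : ∀ᶠ z in L ×ˢ 𝓝[≠] (0 : Plane), P z.1 z.2) :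
    ∀ᶠ z in L ×ˢ 𝓝 (0 : Plane), z.2 ≠ 0 → P z.1 z.2 := by
  obtain ⟨S, hS, U, hU, hSU⟩ := mem_prod_iff.1 h
  rw [mem_nhdsWithin_iff_eventually] at hU
  filter_upwards [prod_mem_prod hS hU] with z hz hz0
  exact hSU ⟨hz.1, hz.2 hz0⟩

section Local

variable {X Y : GASField}

/-- Globalization for properties of points away from the origin; at the origin they are checked
along rescaled directions. -/
lemma globalize_param_punctured {P : GASField × GASField → ℝ → Plane → Prop}
    (h0 : ∀ v ∈ Metric.sphere (0 : Plane) 1,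
      ∀ᶠ z in (jetFilter X Y 0 ×ˢ 𝓝 (0 : ℝ)) ×ˢ (𝓝[>] (0 : ℝ) ×ˢ 𝓝 v),
        P z.1.1 z.1.2 (z.2.1 • z.2.2))
    (h : ∀ c ≠ 0, ∀ᶠ z in (jetFilter X Y c ×ˢ 𝓝 (0 : ℝ)) ×ˢ 𝓝 c, P z.1.1 z.1.2 z.2) :
    ∃ τ : Plane → ℝ, Continuous τ ∧ (∀ x, 0 < τ x) ∧
      ∀ᶠ W in 𝓝 (X, Y), ∀ p ≠ 0, ∀ s, |s| ≤ τ p → P W s p := by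
  obtain ⟨τ, hc, hp, H⟩ := globalize_param (X := X) (Y := Y) (P := fun W s p => p ≠ 0 → P W s p)
    fun c => by
      rcases eq_or_ne c 0 with rfl | hne
      · exact eventually_prod_nhds_of_punctured
          (P := fun (a : (GASField × GASField) × ℝ) p => P a.1 a.2 p)
          (eventually_punctured_of_directions
            (P := fun (a : (GASField × GASField) × ℝ) p => P a.1 a.2 p) h0)
      · exact (h c hne).mono fun z hz _ => hz
  exact ⟨τ, hc, hp, H.mono fun W hW p hp s hs => hW p s hs hp⟩

lemma globalize_punctured {P : GASField × GASField → Plane → Prop}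
    (h0 : ∀ v ∈ Metric.sphere (0 : Plane) 1,
      ∀ᶠ z in jetFilter X Y 0 ×ˢ (𝓝[>] (0 : ℝ) ×ˢ 𝓝 v), P z.1 (z.2.1 • z.2.2))
    (h : ∀ c ≠ 0, ∀ᶠ z in jetFilter X Y c ×ˢ 𝓝 c, P z.1 z.2) :
    ∀ᶠ W in 𝓝 (X, Y), ∀ p ≠ 0, P W p := by
  refine globalize (P := fun W p => p ≠ 0 → P W p) fun c => ?_
  rcases eq_or_ne c 0 with rfl | hne
  · exact eventually_prod_nhds_of_punctured (eventually_punctured_of_directions h0)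
  · exact (h c hne).mono fun z hz _ => hz

lemma ne_zero_of_mem_unit_sphere {v : Plane} (hv : v ∈ Metric.sphere (0 : Plane) 1) : v ≠ 0 := by
  rintro rfl
  simp at hv

lemma tendsto_scale {α : Type*} (L : Filter α) (v : Plane) :
    Tendsto (fun z : α × (ℝ × Plane) => z.2.1) (L ×ˢ (𝓝[>] (0 : ℝ) ×ˢ 𝓝 v)) (𝓝[>] 0) :=
  tendsto_fst.comp tendsto_snd

lemma tendsto_direction {α : Type*} (L : Filter α) (v : Plane) :
    Tendsto (fun z : α × (ℝ × Plane) => z.2.2) (L ×ˢ (𝓝[>] (0 : ℝ) ×ˢ 𝓝 v)) (𝓝 v) :=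
  tendsto_snd.comp tendsto_snd

lemma eventually_Q_ne_zero_direction {v : Plane} (hq : quadQ X Y v ≠ 0) :
    ∀ᶠ z in jetFilter X Y 0 ×ˢ (𝓝[>] (0 : ℝ) ×ˢ 𝓝 v),
      Q z.1.1.1.toFun z.1.2.1.toFun (z.2.1 • z.2.2) ≠ 0 := by
  filter_upwards [(tendsto_Q_rescale tendsto_fst (tendsto_scale _ v)
    (tendsto_direction _ v)).eventually_ne hq] with z hz h
  exact hz (by rw [h, mul_zero])

lemma eventually_Q_ne_zero {c : Plane} (hq : Q X.1.toFun Y.1.toFun c ≠ 0) :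
    ∀ᶠ z in jetFilter X Y c ×ˢ 𝓝 c, Q z.1.1.1.toFun z.1.2.1.toFun z.2 ≠ 0 :=
  (tendsto_Q tendsto_fst tendsto_snd (Metric.mem_ball_self one_pos)).eventually_ne hq

lemma eventually_forall_Q_ne_zero (hq : ∀ v ≠ 0, quadQ X Y v ≠ 0)
    (hQ : ∀ p ≠ 0, Q X.1.toFun Y.1.toFun p ≠ 0) :
    ∀ᶠ W in 𝓝 (X, Y), ∀ p ≠ 0, Q W.1.1.toFun W.2.1.toFun p ≠ 0 :=
  globalize_punctured
    (fun v hv => eventually_Q_ne_zero_direction (hq v (ne_zero_of_mem_unit_sphere hv)))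
    fun c hc => eventually_Q_ne_zero (hQ c hc)

lemma gradient_Q_ne_zero_iff (W : GASField × GASField) (p : Plane) :
    gradient (Q W.1.1.toFun W.2.1.toFun) p ≠ 0 ↔ dQ W p ≠ 0 := by
  rw [gradient, (hasFDerivAt_Q_pair W p).fderiv, Ne, LinearIsometryEquiv.map_eq_zero_iff]

lemma inner_gradient_Q (W : GASField × GASField) (p v : Plane) :
    inner ℝ (gradient (Q W.1.1.toFun W.2.1.toFun) p) v = dQ W p v := by
  rw [inner_gradient_left, (hasFDerivAt_Q_pair W p).fderiv]

/-- The condition `(G1)` persists in the presence of `(G2)`: near the origin `∇Q` is close to the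
non-degenerate linear map given by the Hessian. -/
lemma eventually_G1 (h1 : G1 X.1.toFun Y.1.toFun) (h2 : G2 X.1.toFun Y.1.toFun) :
    ∀ᶠ W in 𝓝 (X, Y), G1 W.1.1.toFun W.2.1.toFun := by
  have H : ∀ᶠ W in 𝓝 (X, Y), ∀ p ≠ 0, Q W.1.1.toFun W.2.1.toFun p = 0 → dQ W p ≠ 0 := by
    refine globalize_punctured (fun v hv => ?_) fun c hc => ?_
    · filter_upwards [(tendsto_dQ_rescale tendsto_fst (tendsto_scale _ v)
        (tendsto_direction _ v)).eventually_ne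
          (hessQ_ne_zero h2 (ne_zero_of_mem_unit_sphere hv))] with z hz _ h
      exact hz (by rw [h, smul_zero])
    · by_cases hQ : Q X.1.toFun Y.1.toFun c = 0
      · have := (gradient_Q_ne_zero_iff (X, Y) c).1 (h1 c hc hQ)
        filter_upwards [(tendsto_dQ tendsto_fst tendsto_snd
          (Metric.mem_ball_self one_pos)).eventually_ne this] with z hz _
        exact hz
      · exact (eventually_Q_ne_zero hQ).mono fun z hz h => absurd h hz
  filter_upwards [H] with W hW p hp hQ
  exact (gradient_Q_ne_zero_iff W p).2 (hW p hp hQ)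

lemma eventually_G2 (h2 : G2 X.1.toFun Y.1.toFun) :
    ∀ᶠ W in 𝓝 (X, Y), G2 W.1.1.toFun W.2.1.toFun := by
  have hW : Tendsto (fun W => W) (𝓝 (X, Y)) (jetFilter X Y 0) := nhds_le_jetFilter X Y 0
  have hA := tendsto_fst_fderiv hW (tendsto_const_nhds (x := 0)) (Metric.mem_ball_self one_pos)
  have hB := tendsto_snd_fderiv hW (tendsto_const_nhds (x := 0)) (Metric.mem_ball_self one_pos)
  have hh : ∀ v w, Tendsto (fun W : GASField × GASField => hessQ W.1 W.2 v w) (𝓝 (X, Y))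
      (𝓝 (hessQ X Y v w)) := fun v w =>
    tendsto_clm_apply (tendsto_crossD (tendsto_clm_apply hA tendsto_const_nhds)
      (tendsto_clm_apply hB tendsto_const_nhds) hA hB) tendsto_const_nhds
  rw [G2_iff] at h2
  filter_upwards [(((hh _ _).mul (hh _ _)).sub ((hh _ _).mul (hh _ _))).eventually_ne h2] with W hW
  exact (G2_iff _ _).2 hW

end Local

/-! ### Tangency points -/

section Tangency

variable {X Y : GASField}

lemma dQ_eq_zero_of_isTangencyPoint {W : GASField × GASField} {p : Plane}
    (h : IsTangencyPoint W.1.1.toFun W.2.1.toFun p) : dQ W p (W.1.1.toFun p) = 0 := by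
  obtain ⟨-, c, hc0, hc, hcZ⟩ := h
  have h1 : HasDerivAt (fun t => Q W.1.1.toFun W.2.1.toFun (c t)) (dQ W p (W.1.1.toFun p)) 0 := by
    have hq := hasFDerivAt_Q_pair W p
    rw [← hc0] at hq
    have := hq.comp_hasDerivAt 0 hc
    rwa [hc0] at this
  have h2 : (fun t => Q W.1.1.toFun W.2.1.toFun (c t)) =ᶠ[𝓝 0] fun _ => 0 :=
    hcZ.mono fun t ht => ht.1
  exact h1.unique ((hasDerivAt_const (0 : ℝ) (0 : ℝ)).congr_of_eventuallyEq h2)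

/-- By the implicit function theorem, a regular point of `Z` where `X Q = 0` is a tangency point. -/
lemma isTangencyPoint_of_dQ_eq_zero {W : GASField × GASField} {p : Plane} (hp : p ≠ 0)
    (hQ : Q W.1.1.toFun W.2.1.toFun p = 0) (hd : dQ W p ≠ 0)
    (ht : dQ W p (W.1.1.toFun p) = 0) : IsTangencyPoint W.1.1.toFun W.2.1.toFun p := by
  have hsm : ContDiff ℝ 2 (Q W.1.1.toFun W.2.1.toFun) := by
    rw [funext (Q_eq W.1.1.toFun W.2.1.toFun)]
    exact cross.isBoundedBilinearMap.contDiff.comp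
      (W.1.contDiff_two.prodMk W.2.contDiff_two)
  have hst : HasStrictFDerivAt (Q W.1.1.toFun W.2.1.toFun) (dQ W p) p := by
    have := hsm.contDiffAt.hasStrictFDerivAt (x := p) two_ne_zero
    rwa [(hasFDerivAt_Q_pair W p).fderiv] at this
  have hr : (dQ W p).range = ⊤ := by
    refine LinearMap.range_eq_top.2 (LinearMap.surjective ?_)
    exact fun h => hd (ContinuousLinearMap.coe_injective h)
  set k : (dQ W p).ker := ⟨W.1.1.toFun p, ht⟩ with hk
  set c : ℝ → Plane := fun t => hst.implicitFunction _ _ hr (Q W.1.1.toFun W.2.1.toFun p) (t • k)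
    with hc
  have hc0 : c 0 = p := by simp [hc]
  have hline : HasDerivAt (fun t : ℝ => t • k) k 0 := by
    simpa using (hasDerivAt_id (0 : ℝ)).smul_const k
  have hcd : HasDerivAt c (W.1.1.toFun p) 0 := by
    have h1 := (hst.to_implicitFunction hr).hasFDerivAt
    rw [← zero_smul ℝ k] at h1
    exact h1.comp_hasDerivAt (0 : ℝ) hline
  refine ⟨⟨hQ, hp⟩, c, hc0, hcd, ?_⟩
  have h1 : Tendsto (fun t : ℝ => (Q W.1.1.toFun W.2.1.toFun p, t • k)) (𝓝 0)
      (𝓝 (Q W.1.1.toFun W.2.1.toFun p, 0)) := by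
    refine tendsto_const_nhds.prodMk_nhds ?_
    simpa using hline.continuousAt.tendsto
  have h2 : ∀ᶠ t in 𝓝 (0 : ℝ), c t ≠ 0 :=
    hcd.continuousAt.eventually_ne (by rwa [hc0])
  filter_upwards [h1.eventually (hst.map_implicitFunction_eq hr), h2] with t ht ht2
  exact ⟨ht.trans hQ, ht2⟩

lemma eventually_critNoTangency (h : CritNoTangency X.1.toFun Y.1.toFun) :
    ∀ᶠ W in 𝓝 (X, Y), CritNoTangency W.1.1.toFun W.2.1.toFun := by
  obtain ⟨h1, h2, hiso, ht⟩ := h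
  have hq : ∀ v ∈ Metric.sphere (0 : Plane) 1, quadQ X Y v ≠ 0 := fun v hv =>
    quadQ_ne_zero h2 hiso (ne_zero_of_mem_unit_sphere hv)
  have H : ∀ᶠ W in 𝓝 (X, Y), ∀ p ≠ 0, Q W.1.1.toFun W.2.1.toFun p = 0 →
      dQ W p (W.1.1.toFun p) ≠ 0 := by
    refine globalize_punctured (fun v hv => ?_) fun c hc => ?_
    · exact (eventually_Q_ne_zero_direction (hq v hv)).mono fun z hz h => absurd h hz
    · by_cases hQ : Q X.1.toFun Y.1.toFun c = 0
      · have hne : dQ (X, Y) c (X.1.toFun c) ≠ 0 := fun h0 => ht c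
          (isTangencyPoint_of_dQ_eq_zero (W := (X, Y)) hc hQ
            ((gradient_Q_ne_zero_iff (X, Y) c).1 (h1 c hc hQ)) h0)
        have hm : c ∈ Metric.ball c 1 := Metric.mem_ball_self one_pos
        filter_upwards [(tendsto_clm_apply (tendsto_dQ tendsto_fst tendsto_snd hm)
          (tendsto_fst_val tendsto_fst tendsto_snd hm)).eventually_ne hne] with z hz _
        exact hz
      · exact (eventually_Q_ne_zero hQ).mono fun z hz h => absurd h hz
  have Hiso : ∀ᶠ W in 𝓝 (X, Y), ∀ᶠ p in 𝓝[≠] (0 : Plane), p ∉ Z W.1.1.toFun W.2.1.toFun :=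
    nhds_le_jetFilter X Y 0 (eventually_punctured_of_directions
      (P := fun (W : GASField × GASField) p => p ∉ Z W.1.1.toFun W.2.1.toFun)
      fun v hv => eventually_Q_ne_zero_direction (hq v hv)).curry
  filter_upwards [eventually_G1 h1 h2, eventually_G2 h2, H, Hiso] with W hW1 hW2 hW3 hW4
  exact ⟨hW1, hW2, hW4, fun p hp => hW3 p hp.1.2 hp.1.1 (dQ_eq_zero_of_isTangencyPoint hp)⟩

lemma exists_smul_of_mem_ker {l : Plane →L[ℝ] ℝ} (hl : l ≠ 0) {v w : Plane} (hv : v ≠ 0)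
    (h1 : l v = 0) (h2 : l w = 0) : ∃ a : ℝ, w = a • v := by
  refine exists_smul_of_cross_eq_zero hv ?_
  by_contra hc
  apply hl
  ext u
  have hu : cross v w • u = cross u w • v + cross v u • w := by
    ext i
    fin_cases i <;> simp [cross_apply] <;> ring
  have := congrArg l hu
  rw [map_add, map_smul, map_smul, map_smul, h1, h2, smul_zero, smul_zero, add_zero,
    smul_eq_mul] at this
  exact (mul_eq_zero.1 this).resolve_left hc

/-- The condition `(G3)` persists when the linearizations have no common eigenvector. Near the
origin no tangency can occur at all: on `Z` the two fields are parallel and non-zero, so both would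
be tangent to `Z`, and in the limit a direction of `Z` at the origin would be a common
eigenvector. -/
lemma eventually_G3 (h2 : G2 X.1.toFun Y.1.toFun) (h3 : G3 X.1.toFun Y.1.toFun)
    (hE : NoCommonEigenvector X.1.toFun Y.1.toFun) :
    ∀ᶠ W in 𝓝 (X, Y), G3 W.1.1.toFun W.2.1.toFun := by
  have H : ∀ᶠ W in 𝓝 (X, Y), ∀ p ≠ 0, p ≠ 0 → Q W.1.1.toFun W.2.1.toFun p = 0 →
      dQ W p (W.1.1.toFun p) = 0 →
      lieDeriv W.1.1.toFun (lieDeriv W.1.1.toFun (Q W.1.1.toFun W.2.1.toFun)) p ≠ 0 := by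
    refine globalize_punctured (fun v hv => ?_) fun c hc => ?_
    · have hv0 := ne_zero_of_mem_unit_sphere hv
      by_cases hq : quadQ X Y v = 0
      · have hvv : hessQ X Y v v = 0 := by rw [hessQ_self, hq, mul_zero]
        have hd := tendsto_dQ_rescale tendsto_fst (tendsto_scale (jetFilter X Y 0) v)
          (tendsto_direction _ v)
        have hdX := tendsto_clm_apply hd (tendsto_fst_rescale tendsto_fst (tendsto_scale _ v)
          (tendsto_direction _ v))
        have hdY := tendsto_clm_apply hd (tendsto_snd_rescale tendsto_fst (tendsto_scale _ v)
          (tendsto_direction _ v))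
        by_cases hA : hessQ X Y v (fderiv ℝ X.1.toFun 0 v) = 0
        · have hB : hessQ X Y v (fderiv ℝ Y.1.toFun 0 v) ≠ 0 := by
            intro hB
            obtain ⟨a, ha⟩ := exists_smul_of_mem_ker (hessQ_ne_zero h2 hv0) hv0 hvv hA
            obtain ⟨b, hb⟩ := exists_smul_of_mem_ker (hessQ_ne_zero h2 hv0) hv0 hvv hB
            exact hE ⟨v, hv0, a, b, ha, hb⟩
          filter_upwards [hdY.eventually_ne hB] with z hz hp hQz hdz
          exfalso
          rw [Q_eq] at hQz
          obtain ⟨k, hk⟩ := exists_smul_of_cross_eq_zero (z.1.1.ne_zero hp) hQz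
          apply hz
          rw [hk, _root_.smul_apply, map_smul, map_smul, hdz]
          simp
        · filter_upwards [hdX.eventually_ne hA] with z hz hp hQz hdz
          exfalso
          apply hz
          rw [_root_.smul_apply, map_smul, hdz]
          simp
      · exact (eventually_Q_ne_zero_direction hq).mono fun z hz _ h => absurd h hz
    · have hm : c ∈ Metric.ball c 1 := Metric.mem_ball_self one_pos
      by_cases hQ : Q X.1.toFun Y.1.toFun c = 0
      · by_cases hd : dQ (X, Y) c (X.1.toFun c) = 0
        · have := h3 c hc hQ ((inner_gradient_Q (X, Y) c _).trans hd)
          filter_upwards [(tendsto_lieDeriv_lieDeriv_Q tendsto_fst tendsto_snd hm).eventually_ne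
            this] with z hz _ _ _
          exact hz
        · filter_upwards [(tendsto_clm_apply (tendsto_dQ tendsto_fst tendsto_snd hm)
            (tendsto_fst_val tendsto_fst tendsto_snd hm)).eventually_ne hd] with z hz _ _ h
          exact absurd h hz
      · exact (eventually_Q_ne_zero hQ).mono fun z hz _ h => absurd h hz
  filter_upwards [H] with W hW p hp hQ hd
  exact hW p hp hp hQ ((inner_gradient_Q W p _).symm.trans hd)

end Tangency

/-! ### Inverse components -/

section Inverse

variable {X Y : GASField}

lemma inner_ne_zero_of_mem_Z (W : GASField × GASField) {p : Plane}
    (hp : p ∈ Z W.1.1.toFun W.2.1.toFun \ {0}) :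
    inner ℝ (W.1.1.toFun p) (W.2.1.toFun p) ≠ 0 := by
  have hQ : cross (W.1.1.toFun p) (W.2.1.toFun p) = 0 := by rw [← Q_eq]; exact hp.1
  obtain ⟨k, hk⟩ := exists_smul_of_cross_eq_zero (W.1.ne_zero hp.2) hQ
  have hY := W.2.ne_zero hp.2
  rw [hk] at hY ⊢
  rw [inner_smul_right, real_inner_self_eq_norm_sq]
  have hk0 : k ≠ 0 := by
    rintro rfl
    simp at hY
  have := norm_ne_zero_iff.2 (W.1.ne_zero hp.2)
  positivity

/-- As neither field vanishes off the origin, the fields have opposite directions along a whole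
component as soon as they do at one of its points. -/
lemma isInverseComponent_of_inner_neg (W : GASField × GASField) {p : Plane}
    (hp : p ∈ Z W.1.1.toFun W.2.1.toFun \ {0})
    (hin : inner ℝ (W.1.1.toFun p) (W.2.1.toFun p) < 0) :
    IsInverseComponent W.1.1.toFun W.2.1.toFun
      (connectedComponentIn (Z W.1.1.toFun W.2.1.toFun \ {0}) p) := by
  refine ⟨⟨p, hp, rfl⟩, fun q hq => ?_⟩
  have hqZ := connectedComponentIn_subset _ _ hq
  have hneg : inner ℝ (W.1.1.toFun q) (W.2.1.toFun q) < 0 := by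
    by_contra! hge
    have hc : Continuous fun x => inner ℝ (W.1.1.toFun x) (W.2.1.toFun x) :=
      W.1.continuous.inner W.2.continuous
    obtain ⟨x, hx, hx0⟩ := isPreconnected_connectedComponentIn.intermediate_value
      (mem_connectedComponentIn hp) hq hc.continuousOn ⟨hin.le, hge⟩
    exact inner_ne_zero_of_mem_Z W (connectedComponentIn_subset _ _ hx) hx0
  have hQ : cross (W.1.1.toFun q) (W.2.1.toFun q) = 0 := by rw [← Q_eq]; exact hqZ.1
  refine ⟨W.1.ne_zero hqZ.2, ?_⟩
  obtain ⟨k, hk⟩ := exists_smul_of_cross_eq_zero (W.1.ne_zero hqZ.2) hQ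
  refine ⟨k, ?_, hk⟩
  rw [hk, inner_smul_right] at hneg
  exact neg_of_mul_neg_left hneg real_inner_self_nonneg

lemma inner_neg_of_isInverseComponent {f g : Plane → Plane} {Γ : Set Plane}
    (h : IsInverseComponent f g Γ) {p : Plane} (hp : p ∈ Γ) : inner ℝ (f p) (g p) < 0 := by
  obtain ⟨h0, k, hk, hY⟩ := h.2 p hp
  rw [hY, inner_smul_right]
  exact mul_neg_of_neg_of_pos hk (real_inner_self_pos.2 h0)

lemma hasDerivAt_Q_line (W : GASField × GASField) (p n : Plane) (s : ℝ) :
    HasDerivAt (fun s : ℝ => Q W.1.1.toFun W.2.1.toFun (p + s • n)) (dQ W (p + s • n) n) s := by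
  have hl : HasDerivAt (fun s : ℝ => p + s • n) n s := by
    simpa using ((hasDerivAt_id s).smul_const n).const_add p
  exact (hasFDerivAt_Q_pair W (p + s • n)).comp_hasDerivAt s hl

lemma eventually_exists_zero_of_dQ_ne_zero {p : Plane} (hQ : Q X.1.toFun Y.1.toFun p = 0)
    (hd : dQ (X, Y) p ≠ 0) {U : Set Plane} (hU : U ∈ 𝓝 p) :
    ∀ᶠ W in 𝓝 (X, Y), ∃ q ∈ U, Q W.1.1.toFun W.2.1.toFun q = 0 := by
  obtain ⟨n, hn⟩ : ∃ n, dQ (X, Y) p n ≠ 0 := by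
    by_contra! hcon
    exact hd (ContinuousLinearMap.ext hcon)
  obtain ⟨ρ, hρ, hρU⟩ := Metric.mem_nhds_iff.1 (inter_mem hU (Metric.ball_mem_nhds p one_pos))
  set f : ℝ → ℝ := fun s => Q X.1.toFun Y.1.toFun (p + s • n) with hf
  have hf0 : f 0 = 0 := by simp [hf, hQ]
  have hderiv : HasDerivAt f (dQ (X, Y) p n) 0 := by
    have h := hasDerivAt_Q_line (X, Y) p n 0
    rwa [zero_smul, add_zero] at h
  have hsl := hderiv.tendsto_slope_zero
  simp only [zero_add, hf0, sub_zero, smul_eq_mul] at hsl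
  have t1 : Tendsto (fun s : ℝ => s) (𝓝[>] 0) (𝓝[≠] 0) :=
    tendsto_id.mono_right (nhdsWithin_mono 0 fun x hx => ne_of_gt hx)
  have t2 : Tendsto (fun s : ℝ => -s) (𝓝[>] 0) (𝓝[≠] 0) := by
    refine tendsto_nhdsWithin_iff.2 ⟨?_, ?_⟩
    · simpa using (continuous_neg.tendsto (0 : ℝ)).mono_left nhdsWithin_le_nhds
    · filter_upwards [self_mem_nhdsWithin] with s hs
      have : (0 : ℝ) < s := hs
      simpa using this.ne'
  have hprod := ((hsl.comp t1).mul (hsl.comp t2)).eventually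
    (lt_mem_nhds (a := 0) (mul_self_pos.2 hn))
  have hsmall : ∀ᶠ s : ℝ in 𝓝[>] 0, s * ‖n‖ < ρ := by
    have hc : Continuous fun s : ℝ => s * ‖n‖ := by fun_prop
    have ht : Tendsto (fun s : ℝ => s * ‖n‖) (𝓝[>] 0) (𝓝 0) := by
      simpa using (hc.tendsto 0).mono_left nhdsWithin_le_nhds
    exact ht.eventually (gt_mem_nhds hρ)
  obtain ⟨s, ⟨hs1, hs2⟩, hs3⟩ := ((hprod.and hsmall).and self_mem_nhdsWithin).exists
  have hs0 : 0 < s := hs3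
  have hball : ∀ r : ℝ, |r| ≤ s → p + r • n ∈ Metric.ball p ρ := fun r hr => by
    rw [mem_ball_iff_norm, add_sub_cancel_left, norm_smul, Real.norm_eq_abs]
    exact (mul_le_mul_of_nonneg_right hr (norm_nonneg n)).trans_lt hs2
  have hneg : f (-s) * f s < 0 := by
    simp only [Function.comp_apply] at hs1
    have e : s⁻¹ * f s * ((-s)⁻¹ * f (-s)) = -((s⁻¹) ^ 2 * (f (-s) * f s)) := by
      rw [inv_neg]; ring
    rw [e] at hs1
    exact neg_of_mul_neg_right (neg_pos.1 hs1) (by positivity)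
  have hW : Tendsto (fun W => W) (𝓝 (X, Y)) (jetFilter X Y p) := nhds_le_jetFilter X Y p
  have hlim := (tendsto_Q hW tendsto_const_nhds
      (hρU (hball (-s) (by rw [abs_neg, abs_of_pos hs0]))).2).mul
    (tendsto_Q hW tendsto_const_nhds (hρU (hball s (by rw [abs_of_pos hs0]))).2)
  filter_upwards [hlim.eventually (gt_mem_nhds hneg)] with W hWs
  obtain ⟨r, hr, hr0⟩ := exists_zero_of_mul_neg
    (f := fun r => Q W.1.1.toFun W.2.1.toFun (p + r • n)) (a := -s) (b := s)
    ((continuous_Q_pair W).comp (by fun_prop)) hWs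
  rw [uIcc_of_le (by linarith)] at hr
  exact ⟨_, (hρU (hball r (abs_le.2 hr))).1, hr0⟩

/-- Pairs with opposite directions at a point stay so, uniformly near the point. -/
lemma eventually_inner_neg {p : Plane} (hin : inner ℝ (X.1.toFun p) (Y.1.toFun p) < 0) :
    ∃ U ∈ 𝓝 p, ∀ᶠ W in 𝓝 (X, Y), ∀ q ∈ U, inner ℝ (W.1.1.toFun q) (W.2.1.toFun q) < 0 := by
  have hm : p ∈ Metric.ball p 1 := Metric.mem_ball_self one_pos
  have h := ((tendsto_fst_val (X := X) (Y := Y) tendsto_fst tendsto_snd hm).inner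
    (𝕜 := ℝ) (tendsto_snd_val tendsto_fst tendsto_snd hm)).eventually (gt_mem_nhds hin)
  obtain ⟨S, hS, U, hU, hSU⟩ := mem_prod_iff.1 h
  refine ⟨U, hU, ?_⟩
  filter_upwards [nhds_le_jetFilter X Y p hS] with W hW q hq
  exact @hSU (W, q) ⟨hW, hq⟩

lemma eventually_critInverse (h1 : G1 X.1.toFun Y.1.toFun)
    (h : CritInverse X.1.toFun Y.1.toFun) :
    ∀ᶠ W in 𝓝 (X, Y), CritInverse W.1.1.toFun W.2.1.toFun := by
  obtain ⟨Γ, hΓ⟩ := h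
  obtain ⟨p, hp, rfl⟩ := hΓ.1
  have hin := inner_neg_of_isInverseComponent hΓ (mem_connectedComponentIn hp)
  obtain ⟨U, hU, hev⟩ := eventually_inner_neg hin
  filter_upwards [hev, eventually_exists_zero_of_dQ_ne_zero hp.1
    ((gradient_Q_ne_zero_iff (X, Y) p).1 (h1 p hp.2 hp.1))
    (inter_mem hU (isOpen_ne.mem_nhds hp.2))] with W hW ⟨q, hq, hq0⟩
  exact ⟨_, isInverseComponent_of_inner_neg W ⟨hq0, hq.2⟩ (hW q hq.1)⟩

lemma eventually_critCompact (h : CritCompact X.1.toFun Y.1.toFun) :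
    ∀ᶠ W in 𝓝 (X, Y), CritCompact W.1.1.toFun W.2.1.toFun := by
  obtain ⟨R, hR⟩ := h.isBounded.subset_closedBall 0
  have H : ∀ᶠ W in 𝓝 (X, Y), ∀ p, R + 1 < ‖p‖ → Q W.1.1.toFun W.2.1.toFun p ≠ 0 := by
    refine globalize fun c => ?_
    by_cases hQ : Q X.1.toFun Y.1.toFun c = 0
    · have hc : ‖c‖ < R + 1 := by
        have := mem_closedBall_zero_iff.1 (hR hQ)
        linarith
      filter_upwards [(tendsto_snd.norm).eventually (gt_mem_nhds hc)] with z hz h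
      exact absurd h hz.not_gt
    · exact (eventually_Q_ne_zero hQ).mono fun z hz _ => hz
  filter_upwards [H] with W hW
  refine Metric.isCompact_of_isClosed_isBounded ?_ ?_
  · exact isClosed_eq (continuous_Q_pair W) continuous_const
  · refine (Metric.isBounded_closedBall (x := 0) (r := R + 1)).subset fun p hp => ?_
    rw [mem_closedBall_zero_iff]
    by_contra! hcon
    exact hW p hcon hp

end Inverse

/-! ### Transporting the zero set along the gradient -/

/-- A family of functions, strictly increasing on symmetric intervals and changing sign there, has
a continuous zero. -/
lemma exists_continuousOn_zero {S : Set Plane} {τ : Plane → ℝ} (hτ : Continuous τ)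
    {G : Plane → ℝ → ℝ} (hG : ∀ s, Continuous fun p => G p s) (hGs : ∀ p, Continuous (G p))
    (hmono : ∀ p ∈ S, StrictMonoOn (G p) (Icc (-τ p) (τ p)))
    (hsign : ∀ p ∈ S, G p (-τ p) < 0 ∧ 0 < G p (τ p)) (hτ0 : ∀ p, 0 < τ p) :
    ∃ T : Plane → ℝ, ContinuousOn T S ∧ ∀ p ∈ S, |T p| ≤ τ p ∧ G p (T p) = 0 := by
  have hex : ∀ p, ∃ t, p ∈ S → t ∈ Icc (-τ p) (τ p) ∧ G p t = 0 := by
    intro p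
    by_cases hp : p ∈ S
    · obtain ⟨t, ht, h0⟩ := exists_zero_of_mul_neg (hGs p)
        (mul_neg_of_neg_of_pos (hsign p hp).1 (hsign p hp).2)
      rw [uIcc_of_le (by linarith [hτ0 p])] at ht
      exact ⟨t, fun _ => ⟨ht, h0⟩⟩
    · exact ⟨0, fun h => absurd h hp⟩
  choose T hT using hex
  refine ⟨T, fun p hp => ?_, fun p hp => ⟨abs_le.2 (hT p hp).1, (hT p hp).2⟩⟩
  obtain ⟨hTm, hT0⟩ := hT p hp
  have hlt1 : -τ p < T p := lt_of_le_of_ne hTm.1 fun h => by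
    have := (hsign p hp).1
    rw [h, hT0] at this
    exact lt_irrefl _ this
  have hlt2 : T p < τ p := lt_of_le_of_ne hTm.2 fun h => by
    have := (hsign p hp).2
    rw [← h, hT0] at this
    exact lt_irrefl _ this
  rw [Metric.continuousWithinAt_iff']
  intro e he
  obtain ⟨t₁, ht₁, ht₁'⟩ := exists_between (max_lt (sub_lt_self (T p) he) hlt1)
  obtain ⟨t₂, ht₂, ht₂'⟩ := exists_between (lt_min (lt_add_of_pos_right (T p) he) hlt2)
  rw [max_lt_iff] at ht₁
  rw [lt_min_iff] at ht₂'
  have g1 : G p t₁ < 0 := by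
    rw [← hT0]
    exact hmono p hp ⟨ht₁.2.le, (ht₁'.trans hlt2).le⟩ hTm ht₁'
  have g2 : 0 < G p t₂ := by
    rw [← hT0]
    exact hmono p hp hTm ⟨(hlt1.trans ht₂).le, ht₂'.2.le⟩ ht₂
  filter_upwards [mem_nhdsWithin_of_mem_nhds (((hG t₁).tendsto p).eventually (gt_mem_nhds g1)),
    mem_nhdsWithin_of_mem_nhds (((hG t₂).tendsto p).eventually (lt_mem_nhds g2)),
    mem_nhdsWithin_of_mem_nhds ((hτ.neg.tendsto p).eventually (gt_mem_nhds ht₁.2)),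
    mem_nhdsWithin_of_mem_nhds ((hτ.tendsto p).eventually (lt_mem_nhds ht₂'.2)),
    self_mem_nhdsWithin] with q hq1 hq2 hq3 hq4 hq
  have hq1 : G q t₁ < 0 := hq1
  have hq2 : 0 < G q t₂ := hq2
  have hq3 : -τ q < t₁ := hq3
  have hq4 : t₂ < τ q := hq4
  have h12 : t₁ < t₂ := ht₁'.trans ht₂
  obtain ⟨hqm, hq0⟩ := hT q hq
  have a1 : t₁ < T q := by
    by_contra! hle
    have := (hmono q hq).monotoneOn hqm ⟨hq3.le, by linarith⟩ hle
    linarith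
  have a2 : T q < t₂ := by
    by_contra! hle
    have := (hmono q hq).monotoneOn ⟨by linarith, hq4.le⟩ hqm hle
    linarith
  rw [Real.dist_eq, abs_lt]
  constructor <;> linarith [ht₁.1, ht₂'.1]

section Gradient

variable {X Y : GASField}

/-- The gradient of `Q`, as the vector dual to `dQ`. -/
def gradQ (X Y : GASField) (p : Plane) : Plane :=
  (InnerProductSpace.toDual ℝ Plane).symm (dQ (X, Y) p)

/-- The gradient of the quadratic part of `Q` at the origin. -/
def gradHess (X Y : GASField) (v : Plane) : Plane :=
  (InnerProductSpace.toDual ℝ Plane).symm (hessQ X Y v)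

lemma dQ_apply_eq_inner (p v : Plane) : dQ (X, Y) p v = inner ℝ (gradQ X Y p) v :=
  InnerProductSpace.toDual_symm_apply.symm

lemma hessQ_gradHess (v : Plane) : hessQ X Y v (gradHess X Y v) = ‖gradHess X Y v‖ ^ 2 := by
  rw [← real_inner_self_eq_norm_sq]
  exact InnerProductSpace.toDual_symm_apply.symm

lemma continuous_gradQ : Continuous (gradQ X Y) := by
  refine (LinearIsometryEquiv.continuous _).comp (continuous_iff_continuousAt.2 fun c => ?_)
  exact tendsto_dQ (tendsto_const_jetFilter (𝓝 c) c) tendsto_id (Metric.mem_ball_self one_pos)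

lemma tendsto_gradQ_rescale {ι : Type*} {L : Filter ι} {t : ι → ℝ} {x : ι → Plane} {v : Plane}
    (ht : Tendsto t L (𝓝[>] 0)) (hx : Tendsto x L (𝓝 v)) :
    Tendsto (fun i => (t i)⁻¹ • gradQ X Y (t i • x i)) L (𝓝 (gradHess X Y v)) := by
  have h := tendsto_dQ_rescale (tendsto_const_jetFilter (X := X) (Y := Y) L 0) ht hx
  refine ((((InnerProductSpace.toDual ℝ Plane).symm.continuous.tendsto _).comp h)).congr fun i => ?_
  simp [gradQ]

/-- Near `Z \ {0}` the derivative of `Q` along the gradient lines of the unperturbed `Q` is bounded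
below, uniformly for all pairs in a Whitney neighbourhood, on segments whose length is a positive
continuous multiple of the gradient. -/
lemma exists_param_dQ_gradQ (h1 : G1 X.1.toFun Y.1.toFun) (h2 : G2 X.1.toFun Y.1.toFun) :
    ∃ τ : Plane → ℝ, Continuous τ ∧ (∀ x, 0 < τ x) ∧
      ∀ᶠ W in 𝓝 (X, Y), ∀ p ≠ 0, ∀ s, |s| ≤ τ p → Q X.1.toFun Y.1.toFun p = 0 →
        ‖gradQ X Y p‖ ^ 2 / 2 < dQ W (p + s • gradQ X Y p) (gradQ X Y p) ∧
          |s| * ‖gradQ X Y p‖ < ‖p‖ / 2 := by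
  refine globalize_param_punctured (fun v hv => ?_) fun c hc => ?_
  · have hv0 := ne_zero_of_mem_unit_sphere hv
    have hN : 0 < ‖gradHess X Y v‖ := by
      rw [norm_pos_iff, gradHess, Ne, LinearIsometryEquiv.map_eq_zero_iff]
      exact hessQ_ne_zero h2 hv0
    set L := (jetFilter X Y 0 ×ˢ 𝓝 (0 : ℝ)) ×ˢ (𝓝[>] (0 : ℝ) ×ˢ 𝓝 v)
    have ht : Tendsto (fun z : ((GASField × GASField) × ℝ) × (ℝ × Plane) => z.2.1) L (𝓝[>] 0) :=
      tendsto_scale _ v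
    have hx : Tendsto (fun z : ((GASField × GASField) × ℝ) × (ℝ × Plane) => z.2.2) L (𝓝 v) :=
      tendsto_direction _ v
    have hs : Tendsto (fun z : ((GASField × GASField) × ℝ) × (ℝ × Plane) => z.1.2) L (𝓝 0) :=
      tendsto_snd.comp tendsto_fst
    have hW : Tendsto (fun z : ((GASField × GASField) × ℝ) × (ℝ × Plane) => z.1.1) L
      (jetFilter X Y 0) := tendsto_fst.comp tendsto_fst
    have hg := tendsto_gradQ_rescale (X := X) (Y := Y) ht hx
    have hy := hx.add (hs.smul hg)
    rw [zero_smul, add_zero] at hy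
    have hd := tendsto_clm_apply (tendsto_dQ_rescale hW ht hy) hg
    rw [hessQ_gradHess] at hd
    have e1 := ((hg.norm.pow 2).div_const 2).eventually_lt hd (half_lt_self (by positivity))
    have e2 : ∀ᶠ z in L, |z.1.2| * ‖z.2.1⁻¹ • gradQ X Y (z.2.1 • z.2.2)‖ < ‖z.2.2‖ / 2 := by
      refine (hs.abs.mul hg.norm).eventually_lt (hx.norm.div_const 2) ?_
      rw [abs_zero, zero_mul]
      have := norm_pos_iff.2 hv0
      positivity
    filter_upwards [e1, e2, ht self_mem_nhdsWithin] with z hz1 hz2 hz3 _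
    have htz : 0 < z.2.1 := hz3
    rw [norm_smul, norm_inv, Real.norm_of_nonneg htz.le] at hz1 hz2
    have hpt : z.2.1 • (z.2.2 + z.1.2 • z.2.1⁻¹ • gradQ X Y (z.2.1 • z.2.2)) =
        z.2.1 • z.2.2 + z.1.2 • gradQ X Y (z.2.1 • z.2.2) := by
      rw [smul_add, smul_comm z.1.2, smul_inv_smul₀ htz.ne']
    rw [hpt, _root_.smul_apply, map_smul, smul_eq_mul, smul_eq_mul] at hz1
    constructor
    · have := mul_lt_mul_of_pos_left hz1 (pow_pos htz 2)
      field_simp at this ⊢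
      linarith
    · rw [norm_smul, Real.norm_of_nonneg htz.le]
      have := mul_lt_mul_of_pos_left hz2 htz
      field_simp at this ⊢
      linarith
  · by_cases hQ : Q X.1.toFun Y.1.toFun c = 0
    · have hN : 0 < ‖gradQ X Y c‖ := by
        rw [norm_pos_iff, gradQ, Ne, LinearIsometryEquiv.map_eq_zero_iff]
        exact (gradient_Q_ne_zero_iff (X, Y) c).1 (h1 c hc hQ)
      set L := (jetFilter X Y c ×ˢ 𝓝 (0 : ℝ)) ×ˢ 𝓝 c
      have hx : Tendsto (fun z : ((GASField × GASField) × ℝ) × Plane => z.2) L (𝓝 c) := tendsto_snd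
      have hs : Tendsto (fun z : ((GASField × GASField) × ℝ) × Plane => z.1.2) L (𝓝 0) :=
        tendsto_snd.comp tendsto_fst
      have hW : Tendsto (fun z : ((GASField × GASField) × ℝ) × Plane => z.1.1) L
        (jetFilter X Y c) := tendsto_fst.comp tendsto_fst
      have hg := (continuous_gradQ (X := X) (Y := Y)).continuousAt.tendsto.comp hx
      have hy := hx.add (hs.smul hg)
      rw [zero_smul, add_zero] at hy
      have hd := tendsto_clm_apply (tendsto_dQ hW hy (Metric.mem_ball_self one_pos)) hg
      rw [dQ_apply_eq_inner, real_inner_self_eq_norm_sq] at hd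
      filter_upwards [((hg.norm.pow 2).div_const 2).eventually_lt hd (half_lt_self (by positivity)),
        (hs.abs.mul hg.norm).eventually_lt (hx.norm.div_const 2) (by
          rw [abs_zero, zero_mul]
          have := norm_pos_iff.2 hc
          positivity)] with z hz1 hz2 _
      exact ⟨hz1, hz2⟩
    · filter_upwards [(((continuous_Q_pair (X, Y)).tendsto c).comp tendsto_snd).eventually_ne hQ]
        with z hz h
      exact absurd h hz

lemma eventually_abs_Q_lt (h1 : G1 X.1.toFun Y.1.toFun) (h2 : G2 X.1.toFun Y.1.toFun)
    {τ : Plane → ℝ} (hτ : Continuous τ) (hτ0 : ∀ x, 0 < τ x) :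
    ∀ᶠ W in 𝓝 (X, Y), ∀ p ≠ 0, Q X.1.toFun Y.1.toFun p = 0 →
      |Q W.1.1.toFun W.2.1.toFun p| < τ p * (‖gradQ X Y p‖ ^ 2 / 2) := by
  refine globalize_punctured (fun v hv => ?_) fun c hc => ?_
  · have hv0 := ne_zero_of_mem_unit_sphere hv
    have hN : 0 < ‖gradHess X Y v‖ := by
      rw [norm_pos_iff, gradHess, Ne, LinearIsometryEquiv.map_eq_zero_iff]
      exact hessQ_ne_zero h2 hv0
    have ht := tendsto_scale (jetFilter X Y 0) v
    have hx := tendsto_direction (jetFilter X Y 0) v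
    by_cases hq : quadQ X Y v = 0
    · have hQ := (tendsto_Q_rescale tendsto_fst ht hx).abs
      have hg := tendsto_gradQ_rescale (X := X) (Y := Y) ht hx
      have hτt := (hτ.tendsto 0).comp (tendsto_smul_zero ht hx)
      filter_upwards [hQ.eventually_lt (hτt.mul ((hg.norm.pow 2).div_const 2)) (by
        rw [hq, abs_zero]
        have := hτ0 0
        positivity), ht self_mem_nhdsWithin] with z hz hz3 _
      have htz : 0 < z.2.1 := hz3
      rw [norm_smul, norm_inv, Real.norm_of_nonneg htz.le, abs_mul, abs_of_pos (by positivity)] at hz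
      have := mul_lt_mul_of_pos_left hz (pow_pos htz 2)
      simp only [Function.comp_apply] at this
      field_simp at this ⊢
      linarith
    · filter_upwards [(tendsto_Q_rescale (tendsto_const_jetFilter (X := X) (Y := Y) _ 0) ht
        hx).eventually_ne hq] with z hz h
      rw [h, mul_zero] at hz
      exact absurd rfl hz
  · by_cases hQ : Q X.1.toFun Y.1.toFun c = 0
    · have hN : 0 < ‖gradQ X Y c‖ := by
        rw [norm_pos_iff, gradQ, Ne, LinearIsometryEquiv.map_eq_zero_iff]
        exact (gradient_Q_ne_zero_iff (X, Y) c).1 (h1 c hc hQ)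
      have hx : Tendsto (fun z : (GASField × GASField) × Plane => z.2) (jetFilter X Y c ×ˢ 𝓝 c)
        (𝓝 c) := tendsto_snd
      have hg := (continuous_gradQ (X := X) (Y := Y)).continuousAt.tendsto.comp hx
      have hτt := (hτ.tendsto c).comp hx
      filter_upwards [(tendsto_Q tendsto_fst hx (Metric.mem_ball_self one_pos)).abs.eventually_lt
        (hτt.mul ((hg.norm.pow 2).div_const 2)) (by
          rw [hQ, abs_zero]
          have := hτ0 c
          positivity)] with z hz _
      exact hz
    · filter_upwards [(((continuous_Q_pair (X, Y)).tendsto c).comp tendsto_snd).eventually_ne hQ]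
        with z hz h
      exact absurd h hz

/-- An unbounded inverse component persists. Moving each point `p` of the component along the
gradient of `Q` to the zero of the perturbed determinant is continuous and changes `p` by at most
`‖p‖ / 2`; the image is connected and unbounded, hence lies in one unbounded component of the
perturbed collinearity set. -/
lemma eventually_unbounded_inverseComponent (h1 : G1 X.1.toFun Y.1.toFun)
    (h2 : G2 X.1.toFun Y.1.toFun) {Γ : Set Plane} (hΓ : IsInverseComponent X.1.toFun Y.1.toFun Γ)
    (hub : ¬ Bornology.IsBounded Γ) :
    ∀ᶠ W in 𝓝 (X, Y), ∃ Γ', IsInverseComponent W.1.1.toFun W.2.1.toFun Γ' ∧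
      ¬ Bornology.IsBounded Γ' := by
  obtain ⟨p₀, hp₀, hΓp⟩ := hΓ.1
  have hp₀Γ : p₀ ∈ Γ := by
    rw [hΓp]
    exact mem_connectedComponentIn hp₀
  have hΓZ : Γ ⊆ Z X.1.toFun Y.1.toFun \ {0} := by
    rw [hΓp]
    exact connectedComponentIn_subset _ _
  have hΓc : IsPreconnected Γ := by
    rw [hΓp]
    exact isPreconnected_connectedComponentIn
  obtain ⟨U, hU, hev⟩ := eventually_inner_neg (inner_neg_of_isInverseComponent hΓ hp₀Γ)
  obtain ⟨ρ, hρ, hρU⟩ := Metric.mem_nhds_iff.1 hU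
  obtain ⟨τ', hτ'c, hτ'0, hτ'⟩ := exists_param_dQ_gradQ h1 h2
  -- The constant cap keeps the point above `p₀` where the fields still have opposite directions.
  set τ : Plane → ℝ := fun p => min (τ' p) (ρ / (‖gradQ X Y p₀‖ + 1)) with hτdef
  have hτc : Continuous τ := hτ'c.min continuous_const
  have hτ0 : ∀ p, 0 < τ p := fun p => lt_min (hτ'0 p) (by positivity)
  filter_upwards [hev, hτ', eventually_abs_Q_lt h1 h2 hτc hτ0] with W hWin hWd hWQ
  have hWd' : ∀ p ∈ Γ, ∀ s, |s| ≤ τ p →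
      ‖gradQ X Y p‖ ^ 2 / 2 < dQ W (p + s • gradQ X Y p) (gradQ X Y p) ∧
        |s| * ‖gradQ X Y p‖ < ‖p‖ / 2 := fun p hp s hs =>
    hWd p (hΓZ hp).2 s (hs.trans (min_le_left _ _)) (hΓZ hp).1
  set G : Plane → ℝ → ℝ := fun p s => Q W.1.1.toFun W.2.1.toFun (p + s • gradQ X Y p) with hG
  have hGd : ∀ p s, HasDerivAt (G p) (dQ W (p + s • gradQ X Y p) (gradQ X Y p)) s := fun p s =>
    hasDerivAt_Q_line W p (gradQ X Y p) s
  have hGs : ∀ p, Continuous (G p) := fun p =>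
    continuous_iff_continuousAt.2 fun s => (hGd p s).continuousAt
  have hGp : ∀ s, Continuous fun p => G p s := fun s =>
    (continuous_Q_pair W).comp (continuous_id.add (continuous_gradQ.const_smul s))
  have hslope : ∀ p ∈ Γ, ∀ x ∈ Icc (-τ p) (τ p), ∀ y ∈ Icc (-τ p) (τ p), x ≤ y →
      ‖gradQ X Y p‖ ^ 2 / 2 * (y - x) ≤ G p y - G p x := fun p hp =>
    (convex_Icc _ _).mul_sub_le_image_sub_of_le_deriv (hGs p).continuousOn
      (fun s _ => (hGd p s).differentiableAt.differentiableWithinAt) fun s hs => by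
        rw [(hGd p s).deriv]
        exact (hWd' p hp s (abs_le.2 (mem_Icc.1 (interior_subset hs)))).1.le
  have hmono : ∀ p ∈ Γ, StrictMonoOn (G p) (Icc (-τ p) (τ p)) := fun p hp =>
    strictMonoOn_of_deriv_pos (convex_Icc _ _) (hGs p).continuousOn fun s hs => by
      rw [(hGd p s).deriv]
      exact (by positivity : (0 : ℝ) ≤ ‖gradQ X Y p‖ ^ 2 / 2).trans_lt
        (hWd' p hp s (abs_le.2 (mem_Icc.1 (interior_subset hs)))).1
  have hsign : ∀ p ∈ Γ, G p (-τ p) < 0 ∧ 0 < G p (τ p) := by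
    intro p hp
    have hτp := hτ0 p
    have hG0 : G p 0 = Q W.1.1.toFun W.2.1.toFun p := by simp [hG]
    have hQ := abs_lt.1 (hWQ p (hΓZ hp).2 (hΓZ hp).1)
    have m0 : (0 : ℝ) ∈ Icc (-τ p) (τ p) := ⟨by linarith, hτp.le⟩
    have m1 : τ p ∈ Icc (-τ p) (τ p) := ⟨by linarith, le_rfl⟩
    have m2 : -τ p ∈ Icc (-τ p) (τ p) := ⟨le_rfl, by linarith⟩
    have s1 := hslope p hp 0 m0 (τ p) m1 hτp.le
    have s2 := hslope p hp (-τ p) m2 0 m0 (by linarith)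
    rw [hG0] at s1 s2
    constructor <;> nlinarith [hQ.1, hQ.2]
  obtain ⟨T, hTc, hT⟩ := exists_continuousOn_zero hτc hGp hGs hmono hsign hτ0
  set φ : Plane → Plane := fun p => p + T p • gradQ X Y p with hφ
  have hφc : ContinuousOn φ Γ :=
    continuousOn_id.add (hTc.smul continuous_gradQ.continuousOn)
  have hφn : ∀ p ∈ Γ, ‖p‖ / 2 < ‖φ p‖ := by
    intro p hp
    have h := (hWd' p hp (T p) (hT p hp).1).2
    rw [← Real.norm_eq_abs, ← norm_smul] at h
    have := norm_sub_norm_le p (-(T p • gradQ X Y p))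
    rw [norm_neg, sub_neg_eq_add] at this
    change _ ≤ ‖φ p‖ at this
    linarith
  have hφZ : φ '' Γ ⊆ Z W.1.1.toFun W.2.1.toFun \ {0} := by
    rintro _ ⟨p, hp, rfl⟩
    refine ⟨(hT p hp).2, fun h0 => ?_⟩
    have := hφn p hp
    rw [mem_singleton_iff.1 h0, norm_zero] at this
    linarith [norm_nonneg p]
  have hφp₀ : φ p₀ ∈ φ '' Γ := mem_image_of_mem φ hp₀Γ
  refine ⟨_, isInverseComponent_of_inner_neg W (hφZ hφp₀) (hWin _ (hρU ?_)), fun hb => hub ?_⟩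
  · have hT0 := (hT p₀ hp₀Γ).1.trans (min_le_right _ _)
    rw [mem_ball_iff_norm, hφ]
    simp only [add_sub_cancel_left]
    rw [norm_smul, Real.norm_eq_abs]
    calc |T p₀| * ‖gradQ X Y p₀‖ ≤ ρ / (‖gradQ X Y p₀‖ + 1) * ‖gradQ X Y p₀‖ := by gcongr
      _ < ρ := by
        rw [div_mul_eq_mul_div, div_lt_iff₀ (by positivity)]
        nlinarith
  · have hsub := (hΓc.image φ hφc).subset_connectedComponentIn hφp₀ hφZ
    obtain ⟨R, hR⟩ := (hb.subset hsub).subset_closedBall 0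
    refine (Metric.isBounded_closedBall (x := 0) (r := 2 * R)).subset fun p hp => ?_
    have a := mem_closedBall_zero_iff.1 (hR (mem_image_of_mem φ hp))
    have b := hφn p hp
    rw [mem_closedBall_zero_iff]
    linarith

end Gradient

/-! ### Hurwitz matrices -/

lemma isHurwitz_iff (M : Matrix (Fin 2) (Fin 2) ℝ) : IsHurwitz M ↔ M.trace < 0 ∧ 0 < M.det := by
  have hmem : ∀ μ : ℂ, μ ∈ spectrum ℂ (M.map (fun x : ℝ => (x : ℂ))) ↔
      μ ^ 2 - M.trace * μ + M.det = 0 := by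
    intro μ
    rw [Matrix.mem_spectrum_iff_isRoot_charpoly, Matrix.charpoly_fin_two, Polynomial.IsRoot]
    simp [Matrix.trace_fin_two, Matrix.det_fin_two]
  unfold IsHurwitz
  simp only [hmem]
  set t := M.trace
  set d := M.det
  constructor
  · intro h
    obtain ⟨s, hs⟩ := IsAlgClosed.exists_pow_nat_eq ((t : ℂ) ^ 2 - 4 * d) (n := 2) (by norm_num)
    -- The two eigenvalues `(t ± s) / 2` have sum `t` and product `d`.
    have h1 := h ((t + s) / 2) (by linear_combination hs / 4)
    have h2 := h ((t - s) / 2) (by linear_combination hs / 4)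
    have r1 : ((t + s) / 2 : ℂ).re = (t + s.re) / 2 := by simp
    have r2 : ((t - s) / 2 : ℂ).re = (t - s.re) / 2 := by simp
    rw [r1] at h1
    rw [r2] at h2
    refine ⟨by linarith, ?_⟩
    have hre := congrArg Complex.re hs
    simp [pow_two] at hre
    nlinarith [sq_nonneg s.im]
  · rintro ⟨ht, hd⟩ μ hμ
    by_contra! hre
    have e1 := congrArg Complex.re hμ
    have e2 := congrArg Complex.im hμ
    simp [pow_two] at e1 e2
    have e3 : μ.im * (2 * μ.re - t) = 0 := by linarith
    rcases mul_eq_zero.1 e3 with h | h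
    · rw [h] at e1
      nlinarith
    · linarith

lemma eventually_isHurwitz {X Y : GASField}
    (h : IsHurwitz (jacobian X.1.toFun) ∧ IsHurwitz (jacobian Y.1.toFun)) :
    ∀ᶠ W in 𝓝 (X, Y), IsHurwitz (jacobian W.1.1.toFun) ∧ IsHurwitz (jacobian W.2.1.toFun) := by
  have hW : Tendsto (fun W => W) (𝓝 (X, Y)) (jetFilter X Y 0) := nhds_le_jetFilter X Y 0
  have hA := tendsto_fst_fderiv hW (tendsto_const_nhds (x := 0)) (Metric.mem_ball_self one_pos)
  have hB := tendsto_snd_fderiv hW (tendsto_const_nhds (x := 0)) (Metric.mem_ball_self one_pos)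
  have jA : Tendsto (fun W : GASField × GASField => jacobian W.1.1.toFun) (𝓝 (X, Y))
      (𝓝 (jacobian X.1.toFun)) := tendsto_pi_nhds.2 fun i => tendsto_pi_nhds.2 fun j =>
    ((EuclideanSpace.proj i : Plane →L[ℝ] ℝ).continuous.tendsto _).comp
      (tendsto_clm_apply hA tendsto_const_nhds)
  have jB : Tendsto (fun W : GASField × GASField => jacobian W.2.1.toFun) (𝓝 (X, Y))
      (𝓝 (jacobian Y.1.toFun)) := tendsto_pi_nhds.2 fun i => tendsto_pi_nhds.2 fun j =>
    ((EuclideanSpace.proj i : Plane →L[ℝ] ℝ).continuous.tendsto _).comp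
      (tendsto_clm_apply hB tendsto_const_nhds)
  have htr : Continuous fun M : Matrix (Fin 2) (Fin 2) ℝ => M.trace := by fun_prop
  have hdet : Continuous fun M : Matrix (Fin 2) (Fin 2) ℝ => M.det := by fun_prop
  simp only [isHurwitz_iff] at h ⊢
  filter_upwards [((htr.tendsto _).comp jA).eventually (gt_mem_nhds h.1.1),
    ((hdet.tendsto _).comp jA).eventually (lt_mem_nhds h.1.2),
    ((htr.tendsto _).comp jB).eventually (gt_mem_nhds h.2.1),
    ((hdet.tendsto _).comp jB).eventually (lt_mem_nhds h.2.2)] with W a b c d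
  exact ⟨⟨a, b⟩, c, d⟩

/-! ### Linear switched systems -/

section Linear

variable {A B A' B' : Plane →L[ℝ] Plane} {M η T : ℝ} {u : ℝ → ℝ} {p : Plane} {γ γ' : ℝ → Plane}

lemma switchedFamily_norm_le (hA : ‖A‖ ≤ M) (hB : ‖B‖ ≤ M) {r : ℝ} (hr : r ∈ Icc (0 : ℝ) 1)
    (q : Plane) : ‖switchedFamily A B r q‖ ≤ M * ‖q‖ := by
  have h1 := A.le_of_opNorm_le hA q
  have h2 := B.le_of_opNorm_le hB q
  calc ‖r • A q + (1 - r) • B q‖ ≤ r * ‖A q‖ + (1 - r) * ‖B q‖ := by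
        refine (norm_add_le _ _).trans ?_
        rw [norm_smul, norm_smul, Real.norm_of_nonneg hr.1,
          Real.norm_of_nonneg (sub_nonneg.2 hr.2)]
    _ ≤ r * (M * ‖q‖) + (1 - r) * (M * ‖q‖) := by
        have := sub_nonneg.2 hr.2
        have := hr.1
        gcongr
    _ = M * ‖q‖ := by ring

lemma intervalIntegrable_switchedFamily (A B : Plane →L[ℝ] Plane) (hu : IsSwitching (Icc 0 1) u)
    {a b : ℝ} (hγ : ContinuousOn γ (uIcc a b)) :
    IntervalIntegrable (fun s => switchedFamily A B (u s) (γ s)) volume a b := by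
  have hm : AEStronglyMeasurable γ (volume.restrict (uIoc a b)) :=
    (hγ.mono uIoc_subset_uIcc).aestronglyMeasurable measurableSet_uIoc
  have hum : AEStronglyMeasurable u (volume.restrict (uIoc a b)) := hu.1.aestronglyMeasurable
  refine IntervalIntegrable.mono_fun' (g := fun s => max ‖A‖ ‖B‖ * ‖γ s‖)
    (hγ.norm.const_smul (max ‖A‖ ‖B‖)).intervalIntegrable ?_ ?_
  · exact (hum.smul (A.continuous.comp_aestronglyMeasurable hm)).add
      ((aestronglyMeasurable_const.sub hum).smul (B.continuous.comp_aestronglyMeasurable hm))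
  · exact Eventually.of_forall fun s =>
      switchedFamily_norm_le (le_max_left _ _) (le_max_right _ _) (hu.2 s) (γ s)

lemma IsTrajectory.norm_le (hA : ‖A‖ ≤ M) (hB : ‖B‖ ≤ M) (hu : IsSwitching (Icc 0 1) u)
    (h : IsTrajectory (switchedFamily A B) u p T γ) {t : ℝ} (ht : t ∈ Icc 0 T) :
    ‖γ t‖ ≤ ‖p‖ * Real.exp (M * t) := by
  have hM : 0 ≤ M := (norm_nonneg A).trans hA
  obtain ⟨hc, -, he⟩ := h
  have := le_gronwallBound_of_integral_le (w := fun s => ‖γ s‖) (a := ‖p‖) (b := 0) (K := M)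
    (norm_nonneg p) le_rfl hM hc.norm (fun _ _ => norm_nonneg _) (fun s hs => by
      have h1 : ‖∫ r in (0 : ℝ)..s, switchedFamily A B (u r) (γ r)‖ ≤
          ∫ r in (0 : ℝ)..s, (M * ‖γ r‖ + 0) := by
        refine intervalIntegral.norm_integral_le_of_norm_le hs.1 (Eventually.of_forall
          fun r _ => ?_) ?_
        · rw [add_zero]
          exact switchedFamily_norm_le hA hB (hu.2 r) _
        · refine ContinuousOn.intervalIntegrable ?_
          rw [uIcc_of_le hs.1]
          exact ((hc.norm.mono (Icc_subset_Icc le_rfl hs.2)).const_smul M).add continuousOn_const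
      calc ‖γ s‖ = ‖p + ∫ r in (0 : ℝ)..s, switchedFamily A B (u r) (γ r)‖ := by rw [← he s hs]
        _ ≤ _ := (norm_add_le _ _).trans (by gcongr)) t ht
  rwa [gronwallBound_ε0] at this

/-- Trajectories of two nearby linear switched systems with the same switching function and the
same initial point stay close. -/
lemma IsTrajectory.norm_sub_le (hA : ‖A‖ ≤ M) (hB : ‖B‖ ≤ M) (hA' : ‖A'‖ ≤ M) (hB' : ‖B'‖ ≤ M)
    (hAη : ‖A' - A‖ ≤ η) (hBη : ‖B' - B‖ ≤ η) (hu : IsSwitching (Icc 0 1) u)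
    (h : IsTrajectory (switchedFamily A B) u p T γ)
    (h' : IsTrajectory (switchedFamily A' B') u p T γ') {t : ℝ} (ht : t ∈ Icc 0 T) :
    ‖γ' t - γ t‖ ≤ gronwallBound 0 M (η * (‖p‖ * Real.exp (M * T))) t := by
  have hM : 0 ≤ M := (norm_nonneg A).trans hA
  have hη : 0 ≤ η := (norm_nonneg _).trans hAη
  have hbd : ∀ s ∈ Icc 0 T, ‖γ s‖ ≤ ‖p‖ * Real.exp (M * T) := fun s hs =>
    (h.norm_le hA hB hu hs).trans (by gcongr; exact hs.2)
  obtain ⟨hc, hi, he⟩ := h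
  obtain ⟨hc', hi', he'⟩ := h'
  have hwc : ContinuousOn (fun s => ‖γ' s - γ s‖) (Icc 0 T) := (hc'.sub hc).norm
  refine le_gronwallBound_of_integral_le (w := fun s => ‖γ' s - γ s‖) le_rfl (by positivity) hM
    hwc (fun _ _ => norm_nonneg _) (fun s hs => ?_) t ht
  have hsub : uIcc 0 s ⊆ uIcc 0 T := by
    rw [uIcc_of_le hs.1, uIcc_of_le (hs.1.trans hs.2)]
    exact Icc_subset_Icc le_rfl hs.2
  have h1 : γ' s - γ s = ∫ r in (0 : ℝ)..s,
      (switchedFamily A' B' (u r) (γ' r) - switchedFamily A B (u r) (γ r)) := by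
    rw [intervalIntegral.integral_sub (hi'.mono_set hsub) (hi.mono_set hsub)]
    conv_lhs => rw [he s hs, he' s hs]
    abel
  rw [h1, zero_add]
  refine intervalIntegral.norm_integral_le_of_norm_le hs.1 (Eventually.of_forall fun r hr => ?_) ?_
  · have hdec : switchedFamily A' B' (u r) (γ' r) - switchedFamily A B (u r) (γ r) =
        switchedFamily A' B' (u r) (γ' r - γ r) +
          switchedFamily (⇑(A' - A)) (⇑(B' - B)) (u r) (γ r) := by
      simp only [switchedFamily, map_sub, _root_.sub_apply, smul_sub]
      abel
    rw [hdec]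
    refine (norm_add_le _ _).trans (add_le_add (switchedFamily_norm_le hA' hB' (hu.2 r) _) ?_)
    refine (switchedFamily_norm_le hAη hBη (hu.2 r) _).trans ?_
    gcongr
    exact hbd r ⟨hr.1.le, hr.2.trans hs.2⟩
  · refine ContinuousOn.intervalIntegrable ?_
    rw [uIcc_of_le hs.1]
    exact ((hwc.mono (Icc_subset_Icc le_rfl hs.2)).const_smul M).add continuousOn_const

lemma IsTrajectory.smul (k : ℝ) (h : IsTrajectory (switchedFamily A B) u p T γ) :
    IsTrajectory (switchedFamily A B) u (k • p) T (k • γ) := by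
  obtain ⟨hc, hi, he⟩ := h
  have hlin : ∀ s, switchedFamily A B (u s) ((k • γ) s) = k • switchedFamily A B (u s) (γ s) := by
    intro s
    simp only [switchedFamily, Pi.smul_apply, map_smul, smul_add]
    rw [smul_comm k, smul_comm k]
  refine ⟨hc.const_smul k, ?_, fun t ht => ?_⟩
  · simp only [hlin]
    exact hi.smul k
  · simp only [hlin]
    rw [intervalIntegral.integral_smul, ← smul_add, ← he t ht, Pi.smul_apply]

lemma IsTrajectory.shift {f : ℝ → Plane → Plane} {S a : ℝ} (h : IsTrajectory f u p S γ)
    (ha : 0 ≤ a) (hT : 0 ≤ T) (haT : T + a ≤ S) :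
    IsTrajectory f (fun s => u (s + a)) (γ a) T (fun s => γ (s + a)) := by
  obtain ⟨hc, hi, he⟩ := h
  have hi2 : ∀ b c, b ∈ Icc 0 S → c ∈ Icc 0 S →
      IntervalIntegrable (fun s => f (u s) (γ s)) volume b c := fun b c hb hc =>
    hi.mono_set (uIcc_subset_uIcc (by rwa [uIcc_of_le (hb.1.trans hb.2)])
      (by rwa [uIcc_of_le (hb.1.trans hb.2)]))
  refine ⟨hc.comp (by fun_prop) fun s hs => ⟨by linarith [hs.1], by linarith [hs.2]⟩, ?_,
    fun t ht => ?_⟩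
  · have := (hi2 a (T + a) ⟨ha, by linarith⟩ ⟨by linarith, haT⟩).comp_add_right a
    simpa using this
  · have hm0 : (0 : ℝ) ∈ Icc 0 S := ⟨le_rfl, by linarith⟩
    have hma : a ∈ Icc 0 S := ⟨ha, by linarith⟩
    have hmt : t + a ∈ Icc 0 S := ⟨by linarith [ht.1], by linarith [ht.2]⟩
    change γ (t + a) = _
    rw [intervalIntegral.integral_comp_add_right (fun s => f (u s) (γ s)) a, zero_add,
      he (t + a) hmt, he a hma, add_assoc, intervalIntegral.integral_add_adjacent_intervals
        (hi2 0 a hm0 hma) (hi2 a (t + a) hma hmt)]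

lemma IsTrajectory.apply_zero {f : ℝ → Plane → Plane} (h : IsTrajectory f u p T γ) (hT : 0 ≤ T) :
    γ 0 = p := by
  simpa using h.2.2 0 ⟨le_rfl, hT⟩

lemma IsSwitching.shift {U : Set ℝ} (hu : IsSwitching U u) (a : ℝ) :
    IsSwitching U fun s => u (s + a) :=
  ⟨hu.1.comp (measurable_id.add_const a), fun _ => hu.2 _⟩

/-- The terms of the Picard series of the linear switched system given by `A` and `B`: iterated
integrals, starting from the constant `p`. -/
def picardTerm (A B : Plane →L[ℝ] Plane) (u : ℝ → ℝ) (p : Plane) : ℕ → ℝ → Plane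
  | 0 => fun _ => p
  | n + 1 => fun t => ∫ s in (0 : ℝ)..t, switchedFamily A B (u s) (picardTerm A B u p n s)

lemma continuous_picardTerm (A B : Plane →L[ℝ] Plane) (hu : IsSwitching (Icc 0 1) u) (p : Plane)
    (n : ℕ) : Continuous (picardTerm A B u p n) := by
  induction n with
  | zero => exact continuous_const
  | succ n ih =>
    exact intervalIntegral.continuous_primitive
      (fun a b => intervalIntegrable_switchedFamily A B hu ih.continuousOn) 0

lemma norm_picardTerm_le (hA : ‖A‖ ≤ M) (hB : ‖B‖ ≤ M) (hu : IsSwitching (Icc 0 1) u) (p : Plane)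
    (n : ℕ) {t : ℝ} (ht : 0 ≤ t) :
    ‖picardTerm A B u p n t‖ ≤ ‖p‖ * (M * t) ^ n / n.factorial := by
  induction n generalizing t with
  | zero => simp [picardTerm]
  | succ n ih =>
    have hM : 0 ≤ M := (norm_nonneg A).trans hA
    have h1 : ‖picardTerm A B u p (n + 1) t‖ ≤
        ∫ s in (0 : ℝ)..t, M * (‖p‖ * (M * s) ^ n / n.factorial) := by
      refine intervalIntegral.norm_integral_le_of_norm_le ht (Eventually.of_forall fun s hs => ?_)
        (Continuous.intervalIntegrable (by fun_prop) _ _)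
      exact (switchedFamily_norm_le hA hB (hu.2 s) _).trans
        (mul_le_mul_of_nonneg_left (ih hs.1.le) hM)
    refine h1.trans (le_of_eq ?_)
    have h2 : ∀ s : ℝ, M * (‖p‖ * (M * s) ^ n / n.factorial) =
        (M * ‖p‖ * M ^ n / n.factorial) * s ^ n := fun s => by rw [mul_pow]; ring
    simp only [h2]
    rw [intervalIntegral.integral_const_mul, integral_pow, Nat.factorial_succ]
    push_cast
    have : (n.factorial : ℝ) ≠ 0 := by positivity
    field_simp
    ring

lemma exists_isTrajectory_linear (A B : Plane →L[ℝ] Plane) (hu : IsSwitching (Icc 0 1) u)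
    (p : Plane) (T : ℝ) : ∃ γ, IsTrajectory (switchedFamily A B) u p T γ := by
  set M := max ‖A‖ ‖B‖ with hM
  have hA : ‖A‖ ≤ M := le_max_left _ _
  have hB : ‖B‖ ≤ M := le_max_right _ _
  have hM0 : 0 ≤ M := (norm_nonneg A).trans hA
  rcases lt_or_ge T 0 with hT | hT
  · -- For negative `T` the interval `[0, T]` is empty and only integrability is required.
    refine ⟨fun _ => 0, continuousOn_const, intervalIntegrable_switchedFamily A B hu
      continuousOn_const, fun t ht => absurd (ht.1.trans ht.2) hT.not_ge⟩
  set b : ℕ → ℝ := fun n => ‖p‖ * (M * T) ^ n / n.factorial with hb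
  have hbs : Summable b := by
    have := (Real.summable_pow_div_factorial (M * T)).mul_left ‖p‖
    refine this.congr fun n => ?_
    rw [hb]
    ring
  have hbd : ∀ n, ∀ t ∈ Icc 0 T, ‖picardTerm A B u p n t‖ ≤ b n := fun n t ht =>
    (norm_picardTerm_le hA hB hu p n ht.1).trans (by
      change _ ≤ ‖p‖ * (M * T) ^ n / n.factorial
      have := ht.1
      have := ht.2
      gcongr)
  set γ : ℝ → Plane := fun t => ∑' n, picardTerm A B u p n t with hγ
  have hγc : ContinuousOn γ (Icc 0 T) :=
    continuousOn_tsum (fun n => (continuous_picardTerm A B hu p n).continuousOn) hbs hbd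
  have hsum : ∀ t ∈ Icc 0 T, HasSum (fun n => picardTerm A B u p n t) (γ t) := fun t ht =>
    (hbs.of_norm_bounded fun n => hbd n t ht).hasSum
  refine ⟨γ, hγc, intervalIntegrable_switchedFamily A B hu (by rwa [uIcc_of_le hT]),
    fun t ht => ?_⟩
  have hint : HasSum (fun n => ∫ s in (0 : ℝ)..t, switchedFamily A B (u s) (picardTerm A B u p n s))
      (∫ s in (0 : ℝ)..t, switchedFamily A B (u s) (γ s)) := by
    have hmem : ∀ s ∈ uIoc 0 t, s ∈ Icc 0 T := fun s hs => by
      rw [uIoc_of_le ht.1] at hs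
      exact ⟨hs.1.le, hs.2.trans ht.2⟩
    refine intervalIntegral.hasSum_integral_of_dominated_convergence (fun n _ => M * b n)
      (fun n => ?_) (fun n => Eventually.of_forall fun s hs => ?_)
      (Eventually.of_forall fun s _ => hbs.mul_left M) intervalIntegrable_const
      (Eventually.of_forall fun s hs => ?_)
    · exact (intervalIntegrable_switchedFamily A B hu
        (continuous_picardTerm A B hu p n).continuousOn).aestronglyMeasurable_restrict_uIoc
    · exact (switchedFamily_norm_le hA hB (hu.2 s) _).trans
        (mul_le_mul_of_nonneg_left (hbd n s (hmem s hs)) hM0)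
    · exact (u s • A + (1 - u s) • B).hasSum (hsum s (hmem s hs))
  exact (hsum t ht).unique (HasSum.zero_add (f := fun n => picardTerm A B u p n t) hint)

/-- Uniform attractivity of a linear switched system gives a time after which all trajectories have
contracted by a factor `1 / 2`, and this contraction persists for nearby linear systems. -/
lemma exists_contraction_time (h : GloballyUniformlyAttractive (switchedFamily A B) (Icc 0 1)) :
    ∃ T > 0, ∃ η > 0, ∀ A' B' : Plane →L[ℝ] Plane, ‖A' - A‖ ≤ η → ‖B' - B‖ ≤ η →
      ∀ u, IsSwitching (Icc 0 1) u → ∀ p γ, IsTrajectory (switchedFamily A' B') u p T γ →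
        ‖γ T‖ ≤ ‖p‖ / 2 := by
  obtain ⟨T, hT, hat⟩ := h (1 / 4) (by norm_num) 2 (by norm_num)
  set M := max ‖A‖ ‖B‖ + 1 with hM
  have hlim : Tendsto (fun η => gronwallBound 0 M (η * Real.exp (M * T)) T) (𝓝[>] 0) (𝓝 0) := by
    have hc := (gronwallBound_continuous_ε 0 M T).comp
      (continuous_id.mul (continuous_const (y := Real.exp (M * T))))
    have := (hc.tendsto 0).mono_left (nhdsWithin_le_nhds (s := Ioi 0))
    have e : ((fun ε => gronwallBound 0 M ε T) ∘ (id * fun _ => Real.exp (M * T))) 0 = 0 := by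
      simp [gronwallBound_ε0]
    rw [e] at this
    exact this
  obtain ⟨η, ⟨hη, hη1⟩, hη0⟩ := (((hlim.eventually (gt_mem_nhds (show (0 : ℝ) < 1 / 4 by norm_num))).and
    (eventually_nhdsWithin_of_eventually_nhds (gt_mem_nhds (zero_lt_one' ℝ)))).and
      self_mem_nhdsWithin).exists
  refine ⟨T, hT, η, hη0, fun A' B' hA' hB' u hu p γ hγ => ?_⟩
  have nA : ‖A‖ ≤ M := by linarith [le_max_left ‖A‖ ‖B‖]
  have nB : ‖B‖ ≤ M := by linarith [le_max_right ‖A‖ ‖B‖]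
  have nA' : ‖A'‖ ≤ M := by
    have := norm_le_norm_add_norm_sub' A' A
    linarith [le_max_left ‖A‖ ‖B‖]
  have nB' : ‖B'‖ ≤ M := by
    have := norm_le_norm_add_norm_sub' B' B
    linarith [le_max_right ‖A‖ ‖B‖]
  have hTT : T ∈ Icc 0 T := ⟨hT.le, le_rfl⟩
  rcases eq_or_ne p 0 with rfl | hp
  · have := hγ.norm_le nA' nB' hu hTT
    simpa using this
  have hp0 : 0 < ‖p‖ := norm_pos_iff.2 hp
  have hnorm : ‖‖p‖⁻¹ • p‖ = 1 := by
    rw [norm_smul, norm_inv, norm_norm, inv_mul_cancel₀ hp0.ne']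
  obtain ⟨γ₀, hγ₀, hγ₀T⟩ := hat u hu (‖p‖⁻¹ • p) (by
    rw [mem_ball_zero_iff, hnorm]
    norm_num)
  have h1 := hγ₀.norm_sub_le nA nB nA' nB' hA' hB' hu (hγ.smul ‖p‖⁻¹) hTT
  rw [hnorm, one_mul, Pi.smul_apply] at h1
  rw [mem_ball_zero_iff] at hγ₀T
  have h2 : ‖‖p‖⁻¹ • γ T‖ ≤ 1 / 2 := by
    have := norm_le_norm_add_norm_sub' (‖p‖⁻¹ • γ T) (γ₀ T)
    have : gronwallBound 0 M (η * Real.exp (M * T)) T < 1 / 4 := hη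
    linarith
  rw [norm_smul, norm_inv, norm_norm, inv_mul_le_iff₀ hp0] at h2
  linarith

/-- Iterating the contraction bounds a trajectory at the multiples of `T`; in between, Grönwall's
inequality bounds its growth. -/
lemma isGUAS_of_contraction (hT : 0 < T)
    (h : ∀ u, IsSwitching (Icc 0 1) u → ∀ p γ, IsTrajectory (switchedFamily A B) u p T γ →
      ‖γ T‖ ≤ ‖p‖ / 2) : IsGUAS (switchedFamily A B) (Icc 0 1) := by
  set M := max ‖A‖ ‖B‖ with hM
  have nA : ‖A‖ ≤ M := le_max_left _ _
  have nB : ‖B‖ ≤ M := le_max_right _ _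
  have hM0 : 0 ≤ M := (norm_nonneg A).trans nA
  have hiter : ∀ (u : ℝ → ℝ) (p : Plane) (S : ℝ) (γ : ℝ → Plane), IsSwitching (Icc 0 1) u →
      IsTrajectory (switchedFamily A B) u p S γ → ∀ k : ℕ, k * T ≤ S →
        ‖γ (k * T)‖ ≤ (1 / 2) ^ k * ‖p‖ := by
    intro u p S γ hu hγ k
    induction k with
    | zero =>
      intro hS
      simp only [CharP.cast_eq_zero, zero_mul] at hS
      simp [hγ.apply_zero hS]
    | succ k ih =>
      intro hS
      push_cast at hS ⊢
      have hk0 : 0 ≤ (k : ℝ) * T := by positivity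
      have h1 := h _ (hu.shift (k * T)) _ _ (hγ.shift hk0 hT.le (by linarith))
      have h2 := ih (by linarith)
      rw [show ((k : ℝ) + 1) * T = T + k * T by ring, pow_succ]
      linarith
  refine ⟨fun δ hδ => ⟨δ * Real.exp (-(M * T)), by positivity, ?_⟩, fun δ₁ hδ₁ δ₂ hδ₂ => ?_⟩
  · rintro p hp _ ⟨u, γ, S, hu, hS, hγ, rfl⟩
    rw [mem_ball_zero_iff] at hp ⊢
    set k := ⌊S / T⌋₊ with hk
    have hk1 : k * T ≤ S := by
      rw [← le_div_iff₀ hT]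
      exact Nat.floor_le (by positivity)
    have hk2 : S < (k + 1) * T := by
      rw [← div_lt_iff₀ hT]
      exact Nat.lt_floor_add_one _
    have hk0 : 0 ≤ (k : ℝ) * T := by positivity
    have h1 := (hγ.shift (T := S - k * T) hk0 (by linarith) (by linarith)).norm_le nA nB
      (hu.shift _) (t := S - k * T) ⟨by linarith, le_rfl⟩
    rw [sub_add_cancel] at h1
    have h2 := hiter u p S γ hu hγ k hk1
    have h3 : (1 / 2 : ℝ) ^ k ≤ 1 := pow_le_one₀ (by norm_num) (by norm_num)
    calc ‖γ S‖ ≤ ‖γ (k * T)‖ * Real.exp (M * (S - k * T)) := h1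
      _ ≤ (1 * ‖p‖) * Real.exp (M * T) := by
          gcongr
          · exact h2.trans (by gcongr)
          · linarith
      _ < (1 * (δ * Real.exp (-(M * T)))) * Real.exp (M * T) := by gcongr
      _ = δ := by rw [one_mul, mul_assoc, ← Real.exp_add]; simp
  · obtain ⟨k, hk⟩ := exists_pow_lt_of_lt_one (div_pos hδ₁ hδ₂) (by norm_num : (1 / 2 : ℝ) < 1)
    refine ⟨(k + 1 : ℕ) * T, by positivity, fun u hu p hp => ?_⟩
    obtain ⟨γ, hγ⟩ := exists_isTrajectory_linear A B hu p ((k + 1 : ℕ) * T)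
    refine ⟨γ, hγ, ?_⟩
    rw [mem_ball_zero_iff] at hp ⊢
    rw [lt_div_iff₀ hδ₂] at hk
    calc ‖γ ((k + 1 : ℕ) * T)‖ ≤ (1 / 2) ^ (k + 1) * ‖p‖ := hiter u p _ γ hu hγ _ le_rfl
      _ ≤ (1 / 2) ^ k * δ₂ := by
          gcongr ?_ * ?_
          · exact pow_le_pow_of_le_one (by norm_num) (by norm_num) (Nat.le_succ k)
      _ < δ₁ := hk

end Linear

lemma eventually_critLinearized {X Y : GASField} (h : CritLinearized X.1.toFun Y.1.toFun) :
    ∀ᶠ W in 𝓝 (X, Y), CritLinearized W.1.1.toFun W.2.1.toFun := by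
  obtain ⟨hc, hH, -, hat⟩ := h
  obtain ⟨T, hT, η, hη, hcon⟩ := exists_contraction_time hat
  have hW : Tendsto (fun W => W) (𝓝 (X, Y)) (jetFilter X Y 0) := nhds_le_jetFilter X Y 0
  filter_upwards [eventually_critCompact hc, eventually_isHurwitz hH,
    eventually_pairNear_jetFilter hW hη] with W h1 h2 h3
  have h0 := h3 0 (Metric.mem_ball_self one_pos)
  exact ⟨h1, h2, isGUAS_of_contraction hT (hcon _ _ h0.1.2.1.le h0.2.2.1.le)⟩

/-! ### The origin as the only point of `Z`, and unbounded inverse components -/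

section Criteria

variable {X Y : GASField}

lemma eventually_critOriginOnly (h2 : G2 X.1.toFun Y.1.toFun)
    (h : CritOriginOnly X.1.toFun Y.1.toFun) :
    ∀ᶠ W in 𝓝 (X, Y), CritOriginOnly W.1.1.toFun W.2.1.toFun := by
  have hZ : ∀ p ≠ 0, Q X.1.toFun Y.1.toFun p ≠ 0 := by
    intro p hp hQ
    have : p ∈ Z X.1.toFun Y.1.toFun := hQ
    rw [h] at this
    exact hp this
  have hiso : ∀ᶠ p in 𝓝[≠] (0 : Plane), p ∉ Z X.1.toFun Y.1.toFun := by
    filter_upwards [self_mem_nhdsWithin] with p hp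
    exact hZ p hp
  filter_upwards [eventually_forall_Q_ne_zero (fun v hv => quadQ_ne_zero h2 hiso hv) hZ] with W hW
  refine Subset.antisymm (fun p hp => ?_) ?_
  · by_contra hne
    exact hW p hne hp
  · rintro _ rfl
    change Q _ _ _ = 0
    rw [Q_eq, W.1.map_zero, map_zero]
    rfl

lemma eventually_critUnboundedInverse (h2 : G2 X.1.toFun Y.1.toFun)
    (h : CritUnboundedInverse X.1.toFun Y.1.toFun)
    (h3 : ∀ᶠ W in 𝓝 (X, Y), G3 W.1.1.toFun W.2.1.toFun) :
    ∀ᶠ W in 𝓝 (X, Y), CritUnboundedInverse W.1.1.toFun W.2.1.toFun := by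
  obtain ⟨h1, -, Γ, hΓ, hub⟩ := h
  filter_upwards [eventually_G1 h1 h2, h3, eventually_unbounded_inverseComponent h1 h2 hΓ hub]
    with W a b c
  exact ⟨a, b, c⟩

end Criteria

end PlanarSwitched

end

theorem mainTheorem7 (X Y : PlanarSwitched.GASField)
    (h1 : PlanarSwitched.G1 X Y) (h2 : PlanarSwitched.G2 X Y) :
    (PlanarSwitched.CritOriginOnly X Y →
      PlanarSwitched.HoldsNear PlanarSwitched.CritOriginOnly X Y) ∧
    (PlanarSwitched.CritNoTangency X Y →
      PlanarSwitched.HoldsNear PlanarSwitched.CritNoTangency X Y) ∧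
    (PlanarSwitched.CritCompact X Y →
      PlanarSwitched.HoldsNear PlanarSwitched.CritCompact X Y) ∧
    (PlanarSwitched.CritLinearized X Y →
      PlanarSwitched.HoldsNear PlanarSwitched.CritLinearized X Y) ∧
    (PlanarSwitched.CritInverse X Y →
      PlanarSwitched.HoldsNear PlanarSwitched.CritInverse X Y) ∧
    (PlanarSwitched.NoCommonEigenvector X Y → PlanarSwitched.CritUnboundedInverse X Y →
      PlanarSwitched.HoldsNear PlanarSwitched.CritUnboundedInverse X Y) ∧
    (PlanarSwitched.HoldsNear PlanarSwitched.G3 X Y → PlanarSwitched.CritUnboundedInverse X Y →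
      PlanarSwitched.HoldsNear PlanarSwitched.CritUnboundedInverse X Y) :=
  ⟨PlanarSwitched.eventually_critOriginOnly h2, PlanarSwitched.eventually_critNoTangency,
    PlanarSwitched.eventually_critCompact, PlanarSwitched.eventually_critLinearized,
    PlanarSwitched.eventually_critInverse h1,
    fun hE h => PlanarSwitched.eventually_critUnboundedInverse h2 h
      (PlanarSwitched.eventually_G3 h2 h.2.1 hE),
    fun h3 h => PlanarSwitched.eventually_critUnboundedInverse h2 h h3⟩
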